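/- \textbf{Setting.} Let $(\mathcal C,\mathcal N)$ be a homological category in the sense of Grandis: $\mathcal N$ is an ideal of ``null'' morphisms consisting of the morphisms that factor through an object of some class of objects; every morphism has a kernel and a cokernel with respect to $\mathcal N$; kernels and cokernels are closed under composition; and if $i:A\to B$ is a kernel and $q:B\to Q$ a cokernel with $(\operatorname{coker} i)(\ker q)\in\mathcal N$, then $qi$ is a cokernel followed by a kernel. Put $\operatorname{im} f=\ker(\operatorname{coker} f)$ and $\operatorname{coim} f=\operatorname{coker}(\ker f)$; a morphism $f=(\operatorname{im} f)\,\overline f\,(\operatorname{coim} f)$ is \emph{exact} if $\overline f$ is an isomorphism; a sequence $\xrightarrow{u}\cdot\xrightarrow{w}$ is exact at the middle object if $\operatorname{im}u=\ker w$. A morphism $f$ is an $\mathcal N$-monomorphism if $fh\in\mathcal N$ implies $h\in\mathcal N$; dually for $\mathcal N$-epimorphisms. For $gf\in\mathcal N$ the homology $H(f,g)$ is the cokernel of the morphism from the source of $f$ to $\operatorname{Ker} g$ induced by $f$; equivalently, it is the kernel of the morphism from $\operatorname{Coker} f$ to the target of $g$ induced by $g$. Consider a commutative diagram with null rows ($gf,\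 g'f'\in\mathcal N$) and $b$ exact $$\begin{array}{ccccc}A&\xrightarrow{f}&B&\xrightarrow{g}&C\\ {\scriptstyle a}\downarrow& S&{\scriptstyle b}\downarrow& T&\downarrow{\scriptstyle c}\\ A'&\xrightarrow{f'}&B'&\xrightarrow{g'}&C'\end{array}$$ and let $h:H\to H'$ be the induced morphism of the homologies of the rows. For a commutative square $S$ with top $f:A\to B$, left side $a:A\to A'$, right side $b:B\to B'$ and bottom $f':A'\to B'$, let $l_S:M_S\to\operatorname{Im} b$ be the projection of the pullback $M_S$ of $\operatorname{im} b$ and $\operatorname{im} f'$, let $\lambda_S:A\to M_S$ be the induced morphism, and put $\operatorname{Im}S=\operatorname{Coker}\lambda_S$. Dually, let $r_S:\operatorname{Coim} a\to P_S$ be the morphism into the pushout $P_S$ of $\operatorname{coim} a$ and $\operatorname{coim} f$, let $\rho_S:P_S\to B'$ be the induced morphism, and put $\operatorname{Ker}S=\operatorname{Ker}\rho_S$. The Lambek morphism $\Lambda=\Lambda_{ST}:\operatorname{Im}S\to\operatorname{Ker}T$ is the unique morphism with $r_T\,\overline b^{\,-1}\,l_S=(\ker\rho_T)\,\Lambda\,(\operatorname{coker}\lambda_S)$.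 Let $\check b:\operatorname{Coker} f\to\operatorname{Coker} f'$ and $\hat b:\operatorname{Ker} g\to\operatorname{Ker} g'$ be induced by $b$. Let $\xi:\operatorname{Ker} b\to\operatorname{Ker}\check b$ be induced by $\operatorname{coker} f$, let $\eta:\operatorname{Ker}\check b\to\operatorname{Ker} c$ be induced by the canonical morphism $\operatorname{Coker} f\to C$, and let $k:\operatorname{Ker}(bf)\to\operatorname{Ker} b$ be induced by $f$. Dually, let $\eta':\operatorname{Coker} a\to\operatorname{Coker}\hat b$ be induced by the canonical morphism $A'\to\operatorname{Ker} g'$, let $\xi':\operatorname{Coker}\hat b\to\operatorname{Coker} b$ be induced by $\ker g'$, and let $k':\operatorname{Coker} b\to\operatorname{Coker}(g'b)$ be induced by $g'$. Put $\widehat H=H(k,\eta\xi)$ and $\widehat H'=H(\xi'\eta',k')$, the homologies of $\operatorname{Ker}(bf)\to\operatorname{Ker} b\to\operatorname{Ker} c$ and of $\operatorname{Coker} a\to\operatorname{Coker} b\to\operatorname{Coker}(g'b)$. Let $\theta:\operatorname{Ker} h\to\operatorname{Ker}\eta$ be the canonical morphism compatible with the morphisms of both objects to $\operatorname{Coker}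 f$, and let $\theta':\operatorname{Coker}\eta'\to\operatorname{Coker} h$ be the canonical morphism compatible with the morphisms from $\operatorname{Ker} g'$. Let $S_1$ be the square with rows $\operatorname{coker} f$, $\operatorname{coker} f'$ and columns $b,\check b$, and let $T_1$ be the square with rows $\ker g,\ker g'$ and columns $\hat b,b$. Let $\chi:\operatorname{Coker}\xi\to\operatorname{Ker}S_1$ be the Lambek morphism of the columns $\operatorname{Ker} b\to B\to B'$ and $\operatorname{Ker}\check b\to\operatorname{Coker} f\to\operatorname{Coker} f'$, that is, $(\ker\rho_{S_1})\,\chi\,(\operatorname{coker}\xi)=\varphi\,\ker\check b$ with $\varphi:\operatorname{Coker} f\to P_{S_1}$ the morphism into the pushout. Dually, let $\chi':\operatorname{Im}T_1\to\operatorname{Ker}\xi'$ be the Lambek morphism of the columns $\operatorname{Ker} g\to\operatorname{Ker} g'\to\operatorname{Coker}\hat b$ and $B\to B'\to\operatorname{Coker} b$, that is, $(\ker\xi')\,\chi'\,(\operatorname{coker}\lambda_{T_1})=(\operatorname{coker}\hat b)\,\varphi'$ with $\varphi':M_{T_1}\to\operatorname{Ker} g'$ the projection of the pullback. \textbf{Theorem.}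 There are unique morphisms $\alpha:\widehat H\to\operatorname{Ker} h$, $\beta:\operatorname{Ker} h\to\operatorname{Im}S$, $\beta':\operatorname{Ker}T\to\operatorname{Coker} h$, $\alpha':\operatorname{Coker} h\to\widehat H'$ such that - $\theta\,\alpha\,\pi=v$, where $\pi:\operatorname{Ker}(\eta\xi)\to\widehat H$ is canonical and $v:\operatorname{Ker}(\eta\xi)\to\operatorname{Ker}\eta$ is induced by $\xi$; - $\Lambda_{SS_1}\,\beta=\chi\,(\operatorname{coker}\xi)(\ker\eta)\,\theta$; - $\beta'\,\Lambda_{T_1T}=\theta'\,(\operatorname{coker}\eta')(\ker\xi')\,\chi'$; - $\iota\,\alpha'\,\theta'=v'$, where $\iota:\widehat H'\to\operatorname{Coker}(\xi'\eta')$ is canonical and $v':\operatorname{Coker}\eta'\to\operatorname{Coker}(\xi'\eta')$ is induced by $\xi'$. The resulting sequence $$\widehat H\xrightarrow{\alpha}\operatorname{Ker}(H\xrightarrow{h}H')\xrightarrow{\beta}\operatorname{Im}S\xrightarrow{\Lambda}\operatorname{Ker}T\xrightarrow{\beta'}\operatorname{Coker}(H\xrightarrow{h}H')\xrightarrow{\alpha'}\widehat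 H'$$ is a null sequence, that is, consecutive composites are null. Moreover: (i) If $f$ is exact, then $\alpha$ is an $\mathcal N$-monomorphism. If in addition $(\operatorname{coker} f)\ker b$ is exact, then $\alpha=\ker\beta$ and the sequence is exact at $\operatorname{Ker} h$. (ii) If $g$ and $\eta$ are exact, then the sequence is exact at $\operatorname{Im}S$ and $\Lambda$ is an exact morphism. (i$'$) If $g'$ is exact, then $\alpha'$ is an $\mathcal N$-epimorphism. If in addition $(\operatorname{coker} b)\ker g'$ is exact, then $\alpha'=\operatorname{coker}\beta'$ and the sequence is exact at $\operatorname{Coker} h$. (ii$'$) If $f'$ and $\eta'$ are exact, then the sequence is exact at $\operatorname{Ker}T$ and $\Lambda$ is an exact morphism. -/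

import Mathlib

open CategoryTheory

universe v u

namespace GrandisHom

section Basic

variable {C : Type u} [Category.{v} C] (N : MorphismProperty C)

/-- `k` is a kernel of `f` with respect to the class `N` of null morphisms. -/
structure IsKer {K A B : C} (f : A ⟶ B) (k : K ⟶ A) : Prop where
  null : N (k ≫ f)
  existsUnique_lift : ∀ {X : C} (x : X ⟶ A), N (x ≫ f) → ∃! x' : X ⟶ K, x' ≫ k = x

/-- `l` is a cokernel of `f` with respect to the class `N` of null morphisms. -/
structure IsCok {A B L : C} (f : A ⟶ B) (l : B ⟶ L) : Prop where
  null : N (f ≫ l)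
  existsUnique_desc : ∀ {X : C} (y : B ⟶ X), N (f ≫ y) → ∃! y' : L ⟶ X, l ≫ y' = y

/-- `k` is a kernel (of some morphism). -/
def IsSomeKer {K A : C} (k : K ⟶ A) : Prop := ∃ (B : C) (f : A ⟶ B), IsKer N f k

/-- `l` is a cokernel (of some morphism). -/
def IsSomeCok {B L : C} (l : B ⟶ L) : Prop := ∃ (A : C) (f : A ⟶ B), IsCok N f l

/-- `f` is an `N`-monomorphism. -/
def IsNMono {A B : C} (f : A ⟶ B) : Prop := ∀ {X : C} (h : X ⟶ A), N (h ≫ f) → N h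

/-- `f` is an `N`-epimorphism. -/
def IsNEpi {A B : C} (f : A ⟶ B) : Prop := ∀ {X : C} (k : B ⟶ X), N (f ≫ k) → N k

/-- `(C, N)` is a semiexact category: `N` is an ideal, it is closed (it consists of the morphisms
that factor through an object of some class `O`), and all kernels and cokernels exist. -/
class Semiexact : Prop where
  ideal : ∀ {W X Y Z : C} (h : W ⟶ X) (f : X ⟶ Y) (g : Y ⟶ Z), N f → N (h ≫ f ≫ g)
  closed : ∃ O : ObjectProperty C, ∀ {X Y : C} (f : X ⟶ Y),
    N f ↔ ∃ Z : C, O Z ∧ ∃ (p : X ⟶ Z) (q : Z ⟶ Y), p ≫ q = f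
  exists_ker : ∀ {A B : C} (f : A ⟶ B), ∃ (K : C) (k : K ⟶ A), IsKer N f k
  exists_cok : ∀ {A B : C} (f : A ⟶ B), ∃ (L : C) (l : B ⟶ L), IsCok N f l

/-- `(C, N)` is a homological category: semiexact, with kernels and cokernels closed under
composition, and such that for every kernel `i : A ⟶ B` and every cokernel `q : B ⟶ Q` for which
the composite of a kernel of `q` and a cokernel of `i` is null, `i ≫ q` is a cokernel followed by
a kernel. -/
class Homological : Prop extends Semiexact N where
  ker_comp : ∀ {X Y Z : C} (i : X ⟶ Y) (j : Y ⟶ Z),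
    IsSomeKer N i → IsSomeKer N j → IsSomeKer N (i ≫ j)
  cok_comp : ∀ {X Y Z : C} (p : X ⟶ Y) (q : Y ⟶ Z),
    IsSomeCok N p → IsSomeCok N q → IsSomeCok N (p ≫ q)
  subquotient : ∀ {A B Q K L : C} (i : A ⟶ B) (q : B ⟶ Q) (k : K ⟶ B) (l : B ⟶ L),
    IsSomeKer N i → IsSomeCok N q → IsKer N q k → IsCok N i l → N (k ≫ l) →
    ∃ (H : C) (p : A ⟶ H) (j : H ⟶ Q), IsSomeCok N p ∧ IsSomeKer N j ∧ p ≫ j = i ≫ q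

variable [Semiexact N]

theorem null_comp_left {X Y Z : C} (h : X ⟶ Y) {f : Y ⟶ Z} (hf : N f) : N (h ≫ f) := by
  simpa using Semiexact.ideal h f (𝟙 Z) hf

theorem null_comp_right {X Y Z : C} {f : X ⟶ Y} (hf : N f) (g : Y ⟶ Z) : N (f ≫ g) := by
  simpa using Semiexact.ideal (𝟙 X) f g hf

/-! Chosen kernels and cokernels. -/

noncomputable def kerObj {A B : C} (f : A ⟶ B) : C :=
  (Semiexact.exists_ker (N := N) f).choose

noncomputable def ker {A B : C} (f : A ⟶ B) : kerObj N f ⟶ A :=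
  (Semiexact.exists_ker (N := N) f).choose_spec.choose

theorem isKer_ker {A B : C} (f : A ⟶ B) : IsKer N f (ker N f) :=
  (Semiexact.exists_ker (N := N) f).choose_spec.choose_spec

noncomputable def cokObj {A B : C} (f : A ⟶ B) : C :=
  (Semiexact.exists_cok (N := N) f).choose

noncomputable def cok {A B : C} (f : A ⟶ B) : B ⟶ cokObj N f :=
  (Semiexact.exists_cok (N := N) f).choose_spec.choose

theorem isCok_cok {A B : C} (f : A ⟶ B) : IsCok N f (cok N f) :=
  (Semiexact.exists_cok (N := N) f).choose_spec.choose_spec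

noncomputable def kerLift {A B X : C} (f : A ⟶ B) (x : X ⟶ A) (hx : N (x ≫ f)) :
    X ⟶ kerObj N f :=
  ((isKer_ker N f).existsUnique_lift x hx).choose

@[simp]
theorem kerLift_ker {A B X : C} (f : A ⟶ B) (x : X ⟶ A) (hx : N (x ≫ f)) :
    kerLift N f x hx ≫ ker N f = x :=
  ((isKer_ker N f).existsUnique_lift x hx).choose_spec.1

@[simp]
theorem kerLift_ker_assoc {A B X Z : C} (f : A ⟶ B) (x : X ⟶ A) (hx : N (x ≫ f)) (z : A ⟶ Z) :
    kerLift N f x hx ≫ ker N f ≫ z = x ≫ z := by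
  rw [← Category.assoc, kerLift_ker]

noncomputable def cokDesc {A B X : C} (f : A ⟶ B) (y : B ⟶ X) (hy : N (f ≫ y)) :
    cokObj N f ⟶ X :=
  ((isCok_cok N f).existsUnique_desc y hy).choose

@[simp]
theorem cok_cokDesc {A B X : C} (f : A ⟶ B) (y : B ⟶ X) (hy : N (f ≫ y)) :
    cok N f ≫ cokDesc N f y hy = y :=
  ((isCok_cok N f).existsUnique_desc y hy).choose_spec.1

@[simp]
theorem cok_cokDesc_assoc {A B X Z : C} (f : A ⟶ B) (y : B ⟶ X) (hy : N (f ≫ y)) (z : X ⟶ Z) :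
    cok N f ≫ cokDesc N f y hy ≫ z = y ≫ z := by
  rw [← Category.assoc, cok_cokDesc]

theorem null_ker {A B : C} (f : A ⟶ B) : N (ker N f ≫ f) := (isKer_ker N f).null

theorem null_cok {A B : C} (f : A ⟶ B) : N (f ≫ cok N f) := (isCok_cok N f).null

instance mono_ker {A B : C} (f : A ⟶ B) : Mono (ker N f) where
  right_cancellation {X} g h e := by
    have hn : N ((h ≫ ker N f) ≫ f) := by
      rw [Category.assoc]; exact null_comp_left N h (null_ker N f)
    exact ((isKer_ker N f).existsUnique_lift _ hn).unique e rfl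

instance epi_cok {A B : C} (f : A ⟶ B) : Epi (cok N f) where
  left_cancellation {X} g h e := by
    have hn : N (f ≫ cok N f ≫ h) := by
      rw [← Category.assoc]; exact null_comp_right N (null_cok N f) h
    exact ((isCok_cok N f).existsUnique_desc _ hn).unique e rfl

theorem isNMono_ker {A B : C} (f : A ⟶ B) : IsNMono N (ker N f) := by
  intro X h hh
  obtain ⟨O, hO⟩ := Semiexact.closed (N := N)
  obtain ⟨Z, hZ, p, q, e⟩ := (hO _).1 hh
  have hq : N (q ≫ f) := (hO _).2 ⟨Z, hZ, 𝟙 Z, q ≫ f, by simp⟩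
  refine (hO _).2 ⟨Z, hZ, p, kerLift N f q hq, ?_⟩
  rw [← cancel_mono (ker N f), Category.assoc, kerLift_ker, e]

theorem isNEpi_cok {A B : C} (f : A ⟶ B) : IsNEpi N (cok N f) := by
  intro X h hh
  obtain ⟨O, hO⟩ := Semiexact.closed (N := N)
  obtain ⟨Z, hZ, p, q, e⟩ := (hO _).1 hh
  have hp : N (f ≫ p) := (hO _).2 ⟨Z, hZ, f ≫ p, 𝟙 Z, by simp⟩
  refine (hO _).2 ⟨Z, hZ, cokDesc N f p hp, q, ?_⟩
  rw [← cancel_epi (cok N f), cok_cokDesc_assoc, e]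

/-! Images, coimages, the normal decomposition, exact morphisms and exact sequences. -/

noncomputable abbrev imObj {A B : C} (f : A ⟶ B) : C := kerObj N (cok N f)

noncomputable abbrev im {A B : C} (f : A ⟶ B) : imObj N f ⟶ B := ker N (cok N f)

noncomputable abbrev coimObj {A B : C} (f : A ⟶ B) : C := cokObj N (ker N f)

noncomputable abbrev coim {A B : C} (f : A ⟶ B) : A ⟶ coimObj N f := cok N (ker N f)

/-- The morphism `A ⟶ Im f` through which `f` factors. -/
noncomputable def toIm {A B : C} (f : A ⟶ B) : A ⟶ imObj N f :=
  kerLift N (cok N f) f (null_cok N f)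

/-- The morphism `Coim f ⟶ B` through which `f` factors. -/
noncomputable def fromCoim {A B : C} (f : A ⟶ B) : coimObj N f ⟶ B :=
  cokDesc N (ker N f) f (null_ker N f)

@[simp]
theorem toIm_im {A B : C} (f : A ⟶ B) : toIm N f ≫ im N f = f := kerLift_ker N _ _ _

@[simp]
theorem toIm_im_assoc {A B Z : C} (f : A ⟶ B) (z : B ⟶ Z) :
    toIm N f ≫ im N f ≫ z = f ≫ z := kerLift_ker_assoc N _ _ _ _

@[simp]
theorem coim_fromCoim {A B : C} (f : A ⟶ B) : coim N f ≫ fromCoim N f = f := cok_cokDesc N _ _ _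

@[simp]
theorem coim_fromCoim_assoc {A B Z : C} (f : A ⟶ B) (z : B ⟶ Z) :
    coim N f ≫ fromCoim N f ≫ z = f ≫ z := cok_cokDesc_assoc N _ _ _ _

/-- The middle morphism of the normal decomposition `f = coim f ≫ bar f ≫ im f`. -/
noncomputable def bar {A B : C} (f : A ⟶ B) : coimObj N f ⟶ imObj N f :=
  cokDesc N (ker N f) (toIm N f)
    (isNMono_ker N (cok N f) _ (by
      rw [Category.assoc, toIm_im]; exact null_ker N f))

@[simp]
theorem coim_bar {A B : C} (f : A ⟶ B) : coim N f ≫ bar N f = toIm N f := cok_cokDesc N _ _ _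

@[simp]
theorem bar_im {A B : C} (f : A ⟶ B) : bar N f ≫ im N f = fromCoim N f := by
  rw [← cancel_epi (coim N f), ← Category.assoc, coim_bar, toIm_im, coim_fromCoim]

/-- `f` is an exact morphism. -/
def IsExactMor {A B : C} (f : A ⟶ B) : Prop := IsIso (bar N f)

/-- The sequence `f`, `g` is exact at the middle object: the image of `f` is a kernel of `g`. -/
def ExactAt {X Y Z : C} (f : X ⟶ Y) (g : Y ⟶ Z) : Prop := IsKer N g (im N f)

theorem null_im_comp {X Y Z : C} {f : X ⟶ Y} {g : Y ⟶ Z} (w : N (f ≫ g)) : N (im N f ≫ g) := by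
  rw [← cok_cokDesc N f g w, ← Category.assoc]
  exact null_comp_right N (null_ker N (cok N f)) _

theorem null_comp_coim {X Y Z : C} {f : X ⟶ Y} {g : Y ⟶ Z} (w : N (f ≫ g)) :
    N (f ≫ coim N g) := by
  rw [← kerLift_ker N g f w, Category.assoc]
  exact null_comp_left N _ (null_cok N (ker N g))

/-! Morphisms induced on kernels and cokernels by a commutative square. -/

/-- The morphism of the kernels of the rows `p`, `q` of a square, induced by `g`. -/
noncomputable def kerMap {A B A' B' : C} {p : A ⟶ B} {g : A ⟶ A'} {f : B ⟶ B'} {q : A' ⟶ B'}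
    (sq : CommSq p g f q) : kerObj N p ⟶ kerObj N q :=
  kerLift N q (ker N p ≫ g) (by
    rw [Category.assoc, ← sq.w, ← Category.assoc]; exact null_comp_right N (null_ker N p) f)

@[simp]
theorem kerMap_ker {A B A' B' : C} {p : A ⟶ B} {g : A ⟶ A'} {f : B ⟶ B'} {q : A' ⟶ B'}
    (sq : CommSq p g f q) : kerMap N sq ≫ ker N q = ker N p ≫ g := kerLift_ker N _ _ _

/-- The morphism of the cokernels of the rows `p`, `q` of a square, induced by `f`. -/
noncomputable def cokMap {A B A' B' : C} {p : A ⟶ B} {g : A ⟶ A'} {f : B ⟶ B'} {q : A' ⟶ B'}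
    (sq : CommSq p g f q) : cokObj N p ⟶ cokObj N q :=
  cokDesc N p (f ≫ cok N q) (by
    rw [← Category.assoc, sq.w, Category.assoc]; exact null_comp_left N g (null_cok N q))

@[simp]
theorem cok_cokMap {A B A' B' : C} {p : A ⟶ B} {g : A ⟶ A'} {f : B ⟶ B'} {q : A' ⟶ B'}
    (sq : CommSq p g f q) : cok N p ≫ cokMap N sq = f ≫ cok N q := cok_cokDesc N _ _ _

/-! Homology of a null sequence `X ⟶ Y ⟶ Z`. In a homological category the left homology used
here is canonically isomorphic to the right homology. -/

noncomputable def toCycles {X Y Z : C} (f : X ⟶ Y) (g : Y ⟶ Z) (w : N (f ≫ g)) :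
    X ⟶ kerObj N g := kerLift N g f w

@[simp]
theorem toCycles_ker {X Y Z : C} (f : X ⟶ Y) (g : Y ⟶ Z) (w : N (f ≫ g)) :
    toCycles N f g w ≫ ker N g = f := kerLift_ker N _ _ _

noncomputable def fromOpcycles {X Y Z : C} (f : X ⟶ Y) (g : Y ⟶ Z) (w : N (f ≫ g)) :
    cokObj N f ⟶ Z := cokDesc N f g w

@[simp]
theorem cok_fromOpcycles {X Y Z : C} (f : X ⟶ Y) (g : Y ⟶ Z) (w : N (f ≫ g)) :
    cok N f ≫ fromOpcycles N f g w = g := cok_cokDesc N _ _ _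

/-- The homology of the null sequence. -/
noncomputable abbrev hom {X Y Z : C} (f : X ⟶ Y) (g : Y ⟶ Z) (w : N (f ≫ g)) : C :=
  cokObj N (toCycles N f g w)

/-- The canonical cokernel `Ker g ⟶ H`. -/
noncomputable abbrev homπ {X Y Z : C} (f : X ⟶ Y) (g : Y ⟶ Z) (w : N (f ≫ g)) :
    kerObj N g ⟶ hom N f g w := cok N (toCycles N f g w)

/-- The canonical morphism `H ⟶ Coker f`, the composite of the comparison of the left homology
with the right homology and of the kernel of `Coker f ⟶ Z`. -/
noncomputable def homι {X Y Z : C} (f : X ⟶ Y) (g : Y ⟶ Z) (w : N (f ≫ g)) :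
    hom N f g w ⟶ cokObj N f :=
  cokDesc N (toCycles N f g w) (ker N g ≫ cok N f) (by
    rw [← Category.assoc, toCycles_ker]; exact null_cok N f)

@[simp]
theorem homπ_homι {X Y Z : C} (f : X ⟶ Y) (g : Y ⟶ Z) (w : N (f ≫ g)) :
    homπ N f g w ≫ homι N f g w = ker N g ≫ cok N f := cok_cokDesc N _ _ _

theorem null_homι {X Y Z : C} (f : X ⟶ Y) (g : Y ⟶ Z) (w : N (f ≫ g)) :
    N (homι N f g w ≫ fromOpcycles N f g w) := by
  refine isNEpi_cok N (toCycles N f g w) _ ?_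
  change N (homπ N f g w ≫ homι N f g w ≫ fromOpcycles N f g w)
  rw [← Category.assoc, homπ_homι, Category.assoc, cok_fromOpcycles]
  exact null_ker N g

end Basic

section Lambek

variable {C : Type u} [Category.{v} C] (N : MorphismProperty C) [Semiexact N]

/-! Lambek's invariants `Im S`, `Ker S` of a commutative square `S` with top `f`, left side `a`,
right side `b` and bottom `g`. The pullback of `im b` and `im g` is realized as the kernel of
`im b ≫ coker g`, and the pushout of `coim a` and `coim f` as the cokernel of `ker f ≫ coim a`. -/

variable {A B A' B' : C} {f : A ⟶ B} {a : A ⟶ A'} {b : B ⟶ B'} {g : A' ⟶ B'}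

/-- The pullback of `im b` and `im g`. -/
noncomputable abbrev sqM (_S : CommSq f a b g) : C := kerObj N (im N b ≫ cok N g)

/-- The projection of the pullback to `Im b`. -/
noncomputable abbrev sqL (S : CommSq f a b g) : sqM N S ⟶ imObj N b := ker N (im N b ≫ cok N g)

/-- The projection of the pullback to `Im g`. -/
noncomputable def sqL' (S : CommSq f a b g) : sqM N S ⟶ imObj N g :=
  kerLift N (cok N g) (sqL N S ≫ im N b) (by
    rw [Category.assoc]; exact null_ker N _)

theorem sq_isPullback (S : CommSq f a b g) :
    IsPullback (sqL N S) (sqL' N S) (im N b) (im N g) := by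
  have hw : sqL N S ≫ im N b = sqL' N S ≫ im N g := by
    rw [sqL', kerLift_ker]
  have hn : ∀ {X : C} (x : X ⟶ imObj N b) (y : X ⟶ imObj N g), x ≫ im N b = y ≫ im N g →
      N (x ≫ im N b ≫ cok N g) := by
    intro X x y e
    rw [← Category.assoc, e, Category.assoc]
    exact null_comp_left N _ (null_ker N (cok N g))
  refine ⟨⟨hw⟩, ⟨Limits.PullbackCone.IsLimit.mk hw
    (fun s => kerLift N (im N b ≫ cok N g) s.fst (hn _ _ s.condition)) ?_ ?_ ?_⟩⟩
  · intro s
    exact kerLift_ker N _ _ _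
  · intro s
    rw [← cancel_mono (im N g), Category.assoc, ← hw, ← s.condition, ← Category.assoc]
    congr 1
    exact kerLift_ker N _ _ _
  · intro s m h1 _
    rw [← cancel_mono (sqL N S), h1]
    exact (kerLift_ker N _ _ _).symm

/-- The morphism from `A` to the pullback of `im b` and `im g`. -/
noncomputable def sqLam (S : CommSq f a b g) : A ⟶ sqM N S :=
  kerLift N (im N b ≫ cok N g) (f ≫ toIm N b) (by
    rw [Category.assoc, toIm_im_assoc, ← Category.assoc, S.w, Category.assoc]
    exact null_comp_left N a (null_cok N g))

@[simp]
theorem sqLam_sqL (S : CommSq f a b g) : sqLam N S ≫ sqL N S = f ≫ toIm N b :=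
  kerLift_ker N _ _ _

theorem sqLam_sqL' (S : CommSq f a b g) : sqLam N S ≫ sqL' N S = a ≫ toIm N g := by
  rw [← cancel_mono (im N g), Category.assoc, ← (sq_isPullback N S).w, ← Category.assoc,
    sqLam_sqL]
  simp [S.w]

/-- Lambek's invariant `Im S`. -/
noncomputable abbrev sqIm (S : CommSq f a b g) : C := cokObj N (sqLam N S)

/-- The canonical cokernel onto `Im S`. -/
noncomputable abbrev sqImπ (S : CommSq f a b g) : sqM N S ⟶ sqIm N S := cok N (sqLam N S)

/-- The pushout of `coim a` and `coim f`. -/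
noncomputable abbrev sqP (_S : CommSq f a b g) : C := cokObj N (ker N f ≫ coim N a)

/-- The morphism from `Coim a` to the pushout. -/
noncomputable abbrev sqR (S : CommSq f a b g) : coimObj N a ⟶ sqP N S := cok N (ker N f ≫ coim N a)

/-- The morphism from `Coim f` to the pushout. -/
noncomputable def sqR' (S : CommSq f a b g) : coimObj N f ⟶ sqP N S :=
  cokDesc N (ker N f) (coim N a ≫ sqR N S) (by
    rw [← Category.assoc]; exact null_cok N _)

theorem sq_isPushout (S : CommSq f a b g) :
    IsPushout (coim N a) (coim N f) (sqR N S) (sqR' N S) := by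
  have hw : coim N a ≫ sqR N S = coim N f ≫ sqR' N S := by
    rw [sqR', cok_cokDesc]
  have hn : ∀ {X : C} (x : coimObj N a ⟶ X) (y : coimObj N f ⟶ X),
      coim N a ≫ x = coim N f ≫ y → N ((ker N f ≫ coim N a) ≫ x) := by
    intro X x y e
    rw [Category.assoc, e, ← Category.assoc]
    exact null_comp_right N (null_cok N (ker N f)) _
  refine ⟨⟨hw⟩, ⟨Limits.PushoutCocone.IsColimit.mk hw
    (fun s => cokDesc N (ker N f ≫ coim N a) s.inl (hn _ _ s.condition)) ?_ ?_ ?_⟩⟩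
  · intro s
    exact cok_cokDesc N _ _ _
  · intro s
    rw [← cancel_epi (coim N f), ← Category.assoc, ← hw, ← s.condition, Category.assoc]
    congr 1
    exact cok_cokDesc N _ _ _
  · intro s m h1 _
    rw [← cancel_epi (sqR N S), h1]
    exact (cok_cokDesc N _ _ _).symm

/-- The morphism from the pushout of `coim a` and `coim f` to `B'`. -/
noncomputable def sqRho (S : CommSq f a b g) : sqP N S ⟶ B' :=
  cokDesc N (ker N f ≫ coim N a) (fromCoim N a ≫ g) (by
    rw [Category.assoc, coim_fromCoim_assoc, ← S.w, ← Category.assoc]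
    exact null_comp_right N (null_ker N f) b)

@[simp]
theorem sqR_sqRho (S : CommSq f a b g) : sqR N S ≫ sqRho N S = fromCoim N a ≫ g :=
  cok_cokDesc N _ _ _

theorem sqR'_sqRho (S : CommSq f a b g) : sqR' N S ≫ sqRho N S = fromCoim N f ≫ b := by
  rw [← cancel_epi (coim N f), ← Category.assoc, ← (sq_isPushout N S).w, Category.assoc,
    sqR_sqRho]
  simp [S.w]

/-- Lambek's invariant `Ker S`. -/
noncomputable abbrev sqKer (S : CommSq f a b g) : C := kerObj N (sqRho N S)

/-- The canonical kernel from `Ker S`. -/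
noncomputable abbrev sqKerι (S : CommSq f a b g) : sqKer N S ⟶ sqP N S := ker N (sqRho N S)

end Lambek

/-- A commutative diagram of two consecutive squares with null rows. -/
structure Diagram {C : Type u} [Category.{v} C] (N : MorphismProperty C) where
  {A B C₀ A' B' C' : C}
  f : A ⟶ B
  g : B ⟶ C₀
  f' : A' ⟶ B'
  g' : B' ⟶ C'
  a : A ⟶ A'
  b : B ⟶ B'
  c : C₀ ⟶ C'
  S : CommSq f a b f'
  T : CommSq g b c g'
  null : N (f ≫ g)
  null' : N (f' ≫ g')

namespace Diagram

variable {C : Type u} [Category.{v} C] {N : MorphismProperty C} [Semiexact N] (D : Diagram N)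

/-- The Lambek morphism `Λ : Im S ⟶ Ker T` for `b` exact: the unique morphism such that the
composite of the projection onto `Im S`, of `Λ` and of the inclusion of `Ker T` is the composite
of `sqL` and `sqR`, where `Im b` and `Coim b` are identified through `bar b`. -/
noncomputable def lambek (hb : IsExactMor N D.b) : sqIm N D.S ⟶ sqKer N D.T :=
  haveI : IsIso (bar N D.b) := hb
  kerLift N (sqRho N D.T)
    (cokDesc N (sqLam N D.S) (sqL N D.S ≫ inv (bar N D.b) ≫ sqR N D.T) (by
      rw [← Category.assoc, sqLam_sqL, ← coim_bar]
      simp only [Category.assoc, IsIso.hom_inv_id_assoc]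
      rw [← kerLift_ker N D.g D.f D.null]
      simp only [Category.assoc]
      refine null_comp_left N _ ?_
      rw [← Category.assoc]
      exact null_cok N _))
    (by
      refine isNEpi_cok N (sqLam N D.S) _ ?_
      rw [cok_cokDesc_assoc]
      simp only [Category.assoc, sqR_sqRho]
      rw [← bar_im]
      simp only [Category.assoc, IsIso.inv_hom_id_assoc]
      rw [← Category.assoc, (sq_isPullback N D.S).w, Category.assoc]
      exact null_comp_left N _ (null_im_comp N D.null'))

theorem lambek_spec (hb : IsExactMor N D.b) :
    haveI : IsIso (bar N D.b) := hb
    sqImπ N D.S ≫ D.lambek hb ≫ sqKerι N D.T =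
      sqL N D.S ≫ inv (bar N D.b) ≫ sqR N D.T := by
  unfold lambek sqImπ sqKerι
  simp

/-! The homologies of the rows and the induced morphism `h : H ⟶ H'`. -/

noncomputable abbrev H : C := hom N D.f D.g D.null

noncomputable abbrev H' : C := hom N D.f' D.g' D.null'

/-- `Ker g ⟶ Ker g'` induced by `b`. -/
noncomputable def bHat : kerObj N D.g ⟶ kerObj N D.g' := kerMap N D.T

/-- `Coker f ⟶ Coker f'` induced by `b`. -/
noncomputable def bCheck : cokObj N D.f ⟶ cokObj N D.f' := cokMap N D.S

@[simp]
theorem bHat_ker : D.bHat ≫ ker N D.g' = ker N D.g ≫ D.b := kerMap_ker N D.T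

@[simp]
theorem cok_bCheck : cok N D.f ≫ D.bCheck = D.b ≫ cok N D.f' := cok_cokMap N D.S

theorem cycles_sq : CommSq (toCycles N D.f D.g D.null) D.a D.bHat
    (toCycles N D.f' D.g' D.null') :=
  ⟨by
    rw [← cancel_mono (ker N D.g'), Category.assoc, bHat_ker, ← Category.assoc, toCycles_ker,
      Category.assoc, toCycles_ker, D.S.w]⟩

theorem opcycles_sq : CommSq (fromOpcycles N D.f D.g D.null) D.bCheck D.c
    (fromOpcycles N D.f' D.g' D.null') :=
  ⟨by
    rw [← cancel_epi (cok N D.f), ← Category.assoc, cok_fromOpcycles, ← Category.assoc,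
      cok_bCheck, Category.assoc, cok_fromOpcycles, D.T.w]⟩

/-- The morphism `h : H ⟶ H'` of the homologies of the rows. -/
noncomputable def h : D.H ⟶ D.H' := cokMap N D.cycles_sq

theorem homπ_h : homπ N D.f D.g D.null ≫ D.h = D.bHat ≫ homπ N D.f' D.g' D.null' :=
  cok_cokMap N D.cycles_sq

theorem h_homι : D.h ≫ homι N D.f' D.g' D.null' = homι N D.f D.g D.null ≫ D.bCheck := by
  rw [← cancel_epi (homπ N D.f D.g D.null), ← Category.assoc, homπ_h, Category.assoc, homπ_homι,
    ← Category.assoc, bHat_ker, ← Category.assoc, homπ_homι, Category.assoc, Category.assoc,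
    cok_bCheck]

/-! The left part of the sequence. -/

/-- The square with rows the cokernels of `f` and `f'`. -/
theorem S₁ : CommSq (cok N D.f) D.b D.bCheck (cok N D.f') := ⟨D.cok_bCheck⟩

/-- `ξ : Ker b ⟶ Ker bCheck`, induced by `coker f`. -/
noncomputable def xi : kerObj N D.b ⟶ kerObj N D.bCheck := kerMap N D.S₁.flip

@[simp]
theorem xi_ker : D.xi ≫ ker N D.bCheck = ker N D.b ≫ cok N D.f := kerMap_ker N _

/-- `η : Ker bCheck ⟶ Ker c`, induced by the canonical morphism `Coker f ⟶ C`. -/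
noncomputable def eta : kerObj N D.bCheck ⟶ kerObj N D.c := kerMap N D.opcycles_sq.flip

@[simp]
theorem eta_ker : D.eta ≫ ker N D.c = ker N D.bCheck ≫ fromOpcycles N D.f D.g D.null :=
  kerMap_ker N _

/-- `k : Ker (bf) ⟶ Ker b`, induced by `f`. -/
noncomputable def k : kerObj N (D.f ≫ D.b) ⟶ kerObj N D.b :=
  kerLift N D.b (ker N (D.f ≫ D.b) ≫ D.f) (by
    rw [Category.assoc]; exact null_ker N _)

@[simp]
theorem k_ker : D.k ≫ ker N D.b = ker N (D.f ≫ D.b) ≫ D.f := kerLift_ker N _ _ _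

theorem xi_eta_ker : (D.xi ≫ D.eta) ≫ ker N D.c = ker N D.b ≫ D.g := by
  rw [Category.assoc, eta_ker, ← Category.assoc, xi_ker, Category.assoc, cok_fromOpcycles]

theorem null_k : N (D.k ≫ D.xi ≫ D.eta) := by
  refine isNMono_ker N D.c _ ?_
  rw [Category.assoc, xi_eta_ker, ← Category.assoc, k_ker, Category.assoc]
  exact null_comp_left N _ D.null

/-- `H (Ker (bf) ⟶ Ker b ⟶ Ker c)`. -/
noncomputable abbrev HKer : C := hom N D.k (D.xi ≫ D.eta) D.null_k

/-- The canonical morphism `Ker (ηξ) ⟶ Ker η`, induced by `ξ`. -/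
noncomputable def v : kerObj N (D.xi ≫ D.eta) ⟶ kerObj N D.eta :=
  kerLift N D.eta (ker N (D.xi ≫ D.eta) ≫ D.xi) (by
    rw [Category.assoc]; exact null_ker N _)

/-- The canonical identification of `Ker h` with `Ker η`, compatible with the morphisms of both
to `Coker f`. -/
noncomputable def theta : kerObj N D.h ⟶ kerObj N D.eta :=
  kerLift N D.eta
    (kerLift N D.bCheck (ker N D.h ≫ homι N D.f D.g D.null) (by
      rw [Category.assoc, ← h_homι, ← Category.assoc]
      exact null_comp_right N (null_ker N _) _))
    (by
      refine isNMono_ker N D.c _ ?_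
      rw [Category.assoc, eta_ker, kerLift_ker_assoc, Category.assoc]
      exact null_comp_left N _ (null_homι N _ _ _))

theorem theta_spec : D.theta ≫ ker N D.eta ≫ ker N D.bCheck =
    ker N D.h ≫ homι N D.f D.g D.null := by
  unfold theta
  simp

/-- The diagram formed by the squares `S` and `S₁`. -/
noncomputable def SS₁ : Diagram N where
  f := D.f
  g := cok N D.f
  f' := D.f'
  g' := cok N D.f'
  a := D.a
  b := D.b
  c := D.bCheck
  S := D.S
  T := D.S₁
  null := null_cok N _
  null' := null_cok N _

/-- The morphism from `Coker f` to the pushout of `coker f` and `coim b`. -/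
noncomputable def phi : cokObj N D.f ⟶ sqP N D.S₁ :=
  cokDesc N D.f (coim N D.b ≫ sqR N D.S₁) (by
    have e : D.f ≫ coim N D.b ≫ sqR N D.S₁ =
        toIm N D.f ≫ (ker N (cok N D.f) ≫ coim N D.b) ≫ sqR N D.S₁ := by
      simp only [Category.assoc, toIm_im_assoc]
    rw [e]
    exact null_comp_left N _ (null_cok N _))

@[simp]
theorem cok_phi : cok N D.f ≫ D.phi = coim N D.b ≫ sqR N D.S₁ := cok_cokDesc N _ _ _

@[simp]
theorem phi_sqRho : D.phi ≫ sqRho N D.S₁ = D.bCheck := by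
  rw [← cancel_epi (cok N D.f), ← Category.assoc, cok_phi, Category.assoc, sqR_sqRho,
    coim_fromCoim_assoc, cok_bCheck]

/-- The morphism `Coker ξ ⟶ Ker S₁`. It is the Lambek morphism of the columns
`Ker b ⟶ B ⟶ B'` and `Ker bCheck ⟶ Coker f ⟶ Coker f'`, where `Coker ξ` is the invariant `Im` of
the square formed by `ξ` and `coker f`: for this square the pullback is `Ker bCheck`. -/
noncomputable def lambekCol : cokObj N D.xi ⟶ sqKer N D.S₁ :=
  cokDesc N D.xi
    (kerLift N (sqRho N D.S₁) (ker N D.bCheck ≫ D.phi) (by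
      rw [Category.assoc, phi_sqRho]; exact null_ker N _))
    (by
      refine isNMono_ker N (sqRho N D.S₁) _ ?_
      rw [Category.assoc, kerLift_ker, ← Category.assoc, xi_ker, Category.assoc, cok_phi,
        ← Category.assoc]
      exact null_comp_right N (null_cok N _) _)

theorem lambekCol_spec : cok N D.xi ≫ D.lambekCol ≫ sqKerι N D.S₁ = ker N D.bCheck ≫ D.phi := by
  unfold lambekCol sqKerι
  simp

/-! The right part of the sequence (dual to the left part). -/

/-- The square with rows the kernels of `g` and `g'`. -/
theorem T₁ : CommSq (ker N D.g) D.bHat D.b (ker N D.g') := ⟨D.bHat_ker.symm⟩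

/-- `ξ' : Coker bHat ⟶ Coker b`, induced by `ker g'`. -/
noncomputable def xi' : cokObj N D.bHat ⟶ cokObj N D.b := cokMap N D.T₁.flip

@[simp]
theorem cok_xi' : cok N D.bHat ≫ D.xi' = ker N D.g' ≫ cok N D.b := cok_cokMap N _

/-- `η' : Coker a ⟶ Coker bHat`, induced by the canonical morphism `A' ⟶ Ker g'`. -/
noncomputable def eta' : cokObj N D.a ⟶ cokObj N D.bHat := cokMap N D.cycles_sq.flip

@[simp]
theorem cok_eta' : cok N D.a ≫ D.eta' = toCycles N D.f' D.g' D.null' ≫ cok N D.bHat :=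
  cok_cokMap N _

/-- `Coker b ⟶ Coker (g'b)`, induced by `g'`. -/
noncomputable def k' : cokObj N D.b ⟶ cokObj N (D.b ≫ D.g') :=
  cokDesc N D.b (D.g' ≫ cok N (D.b ≫ D.g')) (by
    rw [← Category.assoc]; exact null_cok N _)

@[simp]
theorem cok_k' : cok N D.b ≫ D.k' = D.g' ≫ cok N (D.b ≫ D.g') := cok_cokDesc N _ _ _

theorem cok_eta'_xi' : cok N D.a ≫ D.eta' ≫ D.xi' = D.f' ≫ cok N D.b := by
  rw [← Category.assoc, cok_eta', Category.assoc, cok_xi', ← Category.assoc, toCycles_ker]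

theorem null_k' : N ((D.eta' ≫ D.xi') ≫ D.k') := by
  refine isNEpi_cok N D.a _ ?_
  rw [← Category.assoc, cok_eta'_xi', Category.assoc, cok_k', ← Category.assoc]
  exact null_comp_right N D.null' _

/-- `H (Coker a ⟶ Coker b ⟶ Coker (g'b))`. -/
noncomputable abbrev HCok : C := hom N (D.eta' ≫ D.xi') D.k' D.null_k'

/-- The canonical morphism `Coker η' ⟶ Coker (ξ'η')`, induced by `ξ'`. -/
noncomputable def v' : cokObj N D.eta' ⟶ cokObj N (D.eta' ≫ D.xi') :=
  cokDesc N D.eta' (D.xi' ≫ cok N (D.eta' ≫ D.xi')) (by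
    rw [← Category.assoc]; exact null_cok N _)

/-- The canonical identification of `Coker η'` with `Coker h`, compatible with the morphisms from
`Ker g'` to both. -/
noncomputable def theta' : cokObj N D.eta' ⟶ cokObj N D.h :=
  cokDesc N D.eta'
    (cokDesc N D.bHat (homπ N D.f' D.g' D.null' ≫ cok N D.h) (by
      rw [← Category.assoc, ← homπ_h, Category.assoc]
      exact null_comp_left N _ (null_cok N _)))
    (by
      refine isNEpi_cok N D.a _ ?_
      rw [← Category.assoc, cok_eta', Category.assoc, cok_cokDesc, ← Category.assoc]
      exact null_comp_right N (null_cok N (toCycles N D.f' D.g' D.null')) _)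

theorem theta'_spec : cok N D.bHat ≫ cok N D.eta' ≫ D.theta' =
    homπ N D.f' D.g' D.null' ≫ cok N D.h := by
  unfold theta'
  simp

/-- The diagram formed by the squares `T₁` and `T`. -/
noncomputable def T₁T : Diagram N where
  f := ker N D.g
  g := D.g
  f' := ker N D.g'
  g' := D.g'
  a := D.bHat
  b := D.b
  c := D.c
  S := D.T₁
  T := D.T
  null := null_ker N _
  null' := null_ker N _

/-- The morphism from the pullback of `im b` and `ker g'` to `Ker g'`. -/
noncomputable def phi' : sqM N D.T₁ ⟶ kerObj N D.g' :=
  kerLift N D.g' (sqL N D.T₁ ≫ im N D.b) (by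
    have e : (sqL N D.T₁ ≫ im N D.b) ≫ D.g' =
        (sqL N D.T₁ ≫ im N D.b ≫ coim N D.g') ≫ fromCoim N D.g' := by
      simp only [Category.assoc, coim_fromCoim]
    rw [e]
    exact null_comp_right N (null_ker N _) _)

@[simp]
theorem phi'_ker : D.phi' ≫ ker N D.g' = sqL N D.T₁ ≫ im N D.b := kerLift_ker N _ _ _

@[simp]
theorem sqLam_phi' : sqLam N D.T₁ ≫ D.phi' = D.bHat := by
  rw [← cancel_mono (ker N D.g'), Category.assoc, phi'_ker, ← Category.assoc, sqLam_sqL,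
    Category.assoc, toIm_im, bHat_ker]

/-- The morphism `Im T₁ ⟶ Ker ξ'`. It is the Lambek morphism of the columns
`Ker g ⟶ Ker g' ⟶ Coker bHat` and `B ⟶ B' ⟶ Coker b`, where `Ker ξ'` is the invariant `Ker` of
the square formed by `ker g'` and `ξ'`: for this square the pushout is `Coker bHat`. -/
noncomputable def lambekCol' : sqIm N D.T₁ ⟶ kerObj N D.xi' :=
  kerLift N D.xi'
    (cokDesc N (sqLam N D.T₁) (D.phi' ≫ cok N D.bHat) (by
      rw [← Category.assoc, sqLam_phi']; exact null_cok N _))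
    (by
      refine isNEpi_cok N (sqLam N D.T₁) _ ?_
      rw [← Category.assoc, cok_cokDesc, Category.assoc, cok_xi', ← Category.assoc, phi'_ker,
        Category.assoc]
      exact null_comp_left N _ (null_ker N (cok N D.b)))

theorem lambekCol'_spec :
    sqImπ N D.T₁ ≫ D.lambekCol' ≫ ker N D.xi' = D.phi' ≫ cok N D.bHat := by
  unfold lambekCol' sqImπ
  simp

/-- The morphisms `α`, `β`, `β'`, `α'` of Nomura's sequence
`HKer ⟶ Ker h ⟶ Im S ⟶ Ker T ⟶ Coker h ⟶ HCok` (the middle one is `lambek`), with the equations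
by which they are constructed:
* `α`, followed by `Ker h ≅ Ker η`, is induced by `v : Ker (ηξ) ⟶ Ker η`;
* `β` is `ker η ≫ coker ξ`, modulo the identifications of `Ker h` with `Ker η` and of `Coker ξ`
  and `Im S` with `Ker S₁` through Lambek morphisms;
* `β'` and `α'` are given by the dual equations. -/
@[ext]
structure NomuraMaps (hb : IsExactMor N D.b) where
  α : D.HKer ⟶ kerObj N D.h
  β : kerObj N D.h ⟶ sqIm N D.S
  β' : sqKer N D.T ⟶ cokObj N D.h
  α' : cokObj N D.h ⟶ D.HCok
  α_eq : homπ N D.k (D.xi ≫ D.eta) D.null_k ≫ α ≫ D.theta = D.v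
  β_eq : β ≫ D.SS₁.lambek hb = D.theta ≫ ker N D.eta ≫ cok N D.xi ≫ D.lambekCol
  β'_eq : D.T₁T.lambek hb ≫ β' = D.lambekCol' ≫ ker N D.xi' ≫ cok N D.eta' ≫ D.theta'
  α'_eq : D.theta' ≫ α' ≫ homι N (D.eta' ≫ D.xi') D.k' D.null_k' = D.v'

end Diagram

end GrandisHom

/-! The proof rests on `isCok_of_homology`, the comparison of left and right homology of a null
sequence. The subquotient axiom makes the composite of the kernel `k` with the cokernel `q` a
cokernel followed by a kernel, and closure of kernels and cokernels under composition identifies the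
two factors as the expected ones.

The Lambek morphisms of `SS₁`, of `T₁T` and of the columns are instances of this comparison, hence
isomorphisms. Thus Ker h ≅ Ker η, Im S ≅ Coker ξ, Ker T ≅ Ker ξ' and Coker h ≅ Coker η'. Under these
identifications β is Ker η → Ker b̌ → Coker ξ, and β' is Ker ξ' → Coker b̂ → Coker η'. Existence,
uniqueness and nullity of the sequence follow.

At Ker h, let μ be the canonical morphism from Ker(ηξ) to Coker f. If f is exact, Ker(bf) → Ker μ is
a cokernel, so π is the coimage of μ (`isCok_ker_mu`) and α is an N-monomorphism. If moreover ξ is a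
cokernel followed by a kernel, then v is the coimage of μ followed by the kernel of Ker η → Coker ξ
(`exists_fac_v`), so α is that kernel.

At Im S, let V be the kernel of Coim g → C'. The comparison shows Ker T to be the cokernel of Ker b
→ Ker b̌ → V, so Λ is the morphism of cokernels induced by Ker b̌ → V. The latter is exact when g
and η are, and then so is the former (`exists_fac_cokernels`), with the image of Ker η as its
kernel. The other half of the theorem is dual. -/

namespace GrandisHom

/-! ### Duality and elementary calculus of kernels and cokernels. -/

section Semiexact

variable {C : Type u} [Category.{v} C] {N : MorphismProperty C} {A B K L X Y Z : C}

theorem IsKer.op {f : A ⟶ B} {k : K ⟶ A} (h : IsKer N f k) : IsCok N.op f.op k.op where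
  null := h.null
  existsUnique_desc y hy := by
    obtain ⟨x, hx, hu⟩ := h.existsUnique_lift y.unop hy
    refine ⟨x.op, Quiver.Hom.unop_inj hx, fun z hz => Quiver.Hom.unop_inj (hu _ ?_)⟩
    rw [← hz]; rfl

theorem IsCok.op {f : A ⟶ B} {l : B ⟶ L} (h : IsCok N f l) : IsKer N.op f.op l.op where
  null := h.null
  existsUnique_lift y hy := by
    obtain ⟨x, hx, hu⟩ := h.existsUnique_desc y.unop hy
    refine ⟨x.op, Quiver.Hom.unop_inj hx, fun z hz => Quiver.Hom.unop_inj (hu _ ?_)⟩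
    rw [← hz]; rfl

theorem IsKer.unop {A B K : Cᵒᵖ} {f : A ⟶ B} {k : K ⟶ A} (h : IsKer N.op f k) :
    IsCok N f.unop k.unop where
  null := h.null
  existsUnique_desc y hy := by
    obtain ⟨x, hx, hu⟩ := h.existsUnique_lift y.op hy
    refine ⟨x.unop, Quiver.Hom.op_inj hx, fun z hz => Quiver.Hom.op_inj (hu _ ?_)⟩
    rw [← hz]; rfl

theorem IsCok.unop {A B L : Cᵒᵖ} {f : A ⟶ B} {l : B ⟶ L} (h : IsCok N.op f l) :
    IsKer N f.unop l.unop where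
  null := h.null
  existsUnique_lift y hy := by
    obtain ⟨x, hx, hu⟩ := h.existsUnique_desc y.op hy
    refine ⟨x.unop, Quiver.Hom.op_inj hx, fun z hz => Quiver.Hom.op_inj (hu _ ?_)⟩
    rw [← hz]; rfl

theorem IsSomeKer.op {k : K ⟶ A} (h : IsSomeKer N k) : IsSomeCok N.op k.op :=
  let ⟨_, _, h⟩ := h; ⟨_, _, h.op⟩

theorem IsSomeCok.op {l : B ⟶ L} (h : IsSomeCok N l) : IsSomeKer N.op l.op :=
  let ⟨_, _, h⟩ := h; ⟨_, _, h.op⟩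

theorem IsSomeKer.unop {A K : Cᵒᵖ} {k : K ⟶ A} (h : IsSomeKer N.op k) : IsSomeCok N k.unop :=
  let ⟨_, _, h⟩ := h; ⟨_, _, h.unop⟩

theorem IsSomeCok.unop {B L : Cᵒᵖ} {l : B ⟶ L} (h : IsSomeCok N.op l) : IsSomeKer N l.unop :=
  let ⟨_, _, h⟩ := h; ⟨_, _, h.unop⟩

theorem IsNMono.unop {A B : Cᵒᵖ} {f : A ⟶ B} (h : IsNMono N.op f) : IsNEpi N f.unop :=
  fun k hk => h k.op hk

/-- With `homological_op`, this dualizes every statement phrased with the predicates `IsKer` and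
`IsCok`. The chosen kernels and cokernels inside a `Diagram` are not matched on the nose by passing
to `Cᵒᵖ`, so results on diagrams are dualized by hand. -/
instance semiexact_op [Semiexact N] : Semiexact N.op where
  ideal h f g hf := by
    have := Semiexact.ideal (N := N) g.unop f.unop h.unop hf
    simpa [MorphismProperty.op] using this
  closed := by
    obtain ⟨O, hO⟩ := Semiexact.closed (N := N)
    refine ⟨O.op, fun {X Y} f => (hO f.unop).trans ⟨?_, ?_⟩⟩
    · rintro ⟨Z, hZ, p, q, e⟩
      exact ⟨.op Z, hZ, q.op, p.op, Quiver.Hom.unop_inj e⟩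
    · rintro ⟨Z, hZ, p, q, e⟩
      exact ⟨Z.unop, hZ, q.unop, p.unop, Quiver.Hom.op_inj e⟩
  exists_ker f :=
    let ⟨_, _, h⟩ := Semiexact.exists_cok (N := N) f.unop
    ⟨_, _, h.op⟩
  exists_cok f :=
    let ⟨_, _, h⟩ := Semiexact.exists_ker (N := N) f.unop
    ⟨_, _, h.op⟩

instance homological_op [Homological N] : Homological N.op where
  ker_comp i j hi hj := (Homological.cok_comp j.unop i.unop hj.unop hi.unop).op
  cok_comp p q hp hq := (Homological.ker_comp q.unop p.unop hq.unop hp.unop).op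
  subquotient i q k l hi hq hk hl hn := by
    obtain ⟨H, p, j, hp, hj, e⟩ := Homological.subquotient q.unop i.unop l.unop k.unop
      hq.unop hi.unop hl.unop hk.unop hn
    exact ⟨.op H, j.op, p.op, hj.op, hp.op, Quiver.Hom.unop_inj e⟩

theorem IsKer.isSomeKer {f : A ⟶ B} {k : K ⟶ A} (h : IsKer N f k) : IsSomeKer N k := ⟨_, _, h⟩

theorem IsCok.isSomeCok {f : A ⟶ B} {l : B ⟶ L} (h : IsCok N f l) : IsSomeCok N l := ⟨_, _, h⟩

theorem IsKer.lift {f : A ⟶ B} {k : K ⟶ A} (h : IsKer N f k) (x : X ⟶ A) (hx : N (x ≫ f)) :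
    ∃ y, y ≫ k = x :=
  (h.existsUnique_lift x hx).exists

theorem IsCok.desc {f : A ⟶ B} {l : B ⟶ L} (h : IsCok N f l) (x : B ⟶ X) (hx : N (f ≫ x)) :
    ∃ y, l ≫ y = x :=
  (h.existsUnique_desc x hx).exists

theorem isKer_of_lift {f : A ⟶ B} {k : K ⟶ A} [Mono k] (hn : N (k ≫ f))
    (h : ∀ {X : C} (x : X ⟶ A), N (x ≫ f) → ∃ y, y ≫ k = x) : IsKer N f k where
  null := hn
  existsUnique_lift x hx := by
    obtain ⟨y, hy⟩ := h x hx
    exact ⟨y, hy, fun z hz => by rw [← cancel_mono k]; exact hz.trans hy.symm⟩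

theorem isCok_of_desc {f : A ⟶ B} {l : B ⟶ L} [Epi l] (hn : N (f ≫ l))
    (h : ∀ {X : C} (x : B ⟶ X), N (f ≫ x) → ∃ y, l ≫ y = x) : IsCok N f l where
  null := hn
  existsUnique_desc x hx := by
    obtain ⟨y, hy⟩ := h x hx
    exact ⟨y, hy, fun z hz => by rw [← cancel_epi l]; exact hz.trans hy.symm⟩

theorem IsNMono.comp {f : A ⟶ B} {g : B ⟶ X} (hf : IsNMono N f) (hg : IsNMono N g) :
    IsNMono N (f ≫ g) := fun x hx => hf _ (hg _ (by rwa [Category.assoc]))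

theorem IsNEpi.comp {f : A ⟶ B} {g : B ⟶ X} (hf : IsNEpi N f) (hg : IsNEpi N g) :
    IsNEpi N (f ≫ g) := fun x hx => hg _ (hf _ (by rwa [← Category.assoc]))

variable [Semiexact N]

theorem IsKer.mono {f : A ⟶ B} {k : K ⟶ A} (h : IsKer N f k) : Mono k where
  right_cancellation x y e := by
    refine (h.existsUnique_lift (y ≫ k) ?_).unique e rfl
    rw [Category.assoc]
    exact null_comp_left N _ h.null

theorem IsCok.epi {f : A ⟶ B} {l : B ⟶ L} (h : IsCok N f l) : Epi l where
  left_cancellation x y e := by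
    refine (h.existsUnique_desc (l ≫ y) ?_).unique e rfl
    rw [← Category.assoc]
    exact null_comp_right N h.null _

theorem IsSomeKer.mono {k : K ⟶ A} (h : IsSomeKer N k) : Mono k :=
  let ⟨_, _, h⟩ := h; h.mono

theorem IsSomeCok.epi {l : B ⟶ L} (h : IsSomeCok N l) : Epi l :=
  let ⟨_, _, h⟩ := h; h.epi

/-- Since `f` factors through `l`, whatever `l` kills is killed by `f`. -/
theorem IsKer.isKer_of_isCok {f : A ⟶ B} {k : K ⟶ A} {l : A ⟶ L} (h : IsKer N f k)
    (hl : IsCok N k l) : IsKer N l k := by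
  have := h.mono
  refine isKer_of_lift hl.null fun x hx => h.lift x ?_
  obtain ⟨y, rfl⟩ := hl.desc f h.null
  rw [← Category.assoc]
  exact null_comp_right N hx y

theorem IsCok.isCok_of_isKer {f : A ⟶ B} {l : B ⟶ L} {k : K ⟶ B} (h : IsCok N f l)
    (hk : IsKer N l k) : IsCok N k l := (h.op.isKer_of_isCok hk.op).unop

theorem IsSomeKer.isKer_of_isCok {k : K ⟶ A} {l : A ⟶ L} (h : IsSomeKer N k)
    (hl : IsCok N k l) : IsKer N l k :=
  let ⟨_, _, h⟩ := h; h.isKer_of_isCok hl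

theorem IsSomeCok.isCok_of_isKer {l : B ⟶ L} {k : K ⟶ B} (h : IsSomeCok N l)
    (hk : IsKer N l k) : IsCok N k l :=
  let ⟨_, _, h⟩ := h; h.isCok_of_isKer hk

theorem IsSomeKer.isNMono {k : K ⟶ A} (h : IsSomeKer N k) : IsNMono N k := by
  obtain ⟨B, f, h⟩ := h
  intro X x hx
  obtain ⟨e, he⟩ := h.lift (ker N f) (null_ker N f)
  obtain ⟨e', he'⟩ := (isKer_ker N f).lift k h.null
  have : IsNMono N (ker N f) := isNMono_ker N f
  have e1 : e' ≫ e = 𝟙 K := by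
    have := h.mono
    rw [← cancel_mono k, Category.assoc, he, he', Category.id_comp]
  have := this (x ≫ e') (by rw [Category.assoc, he']; exact hx)
  have := null_comp_right N this e
  rwa [Category.assoc, e1, Category.comp_id] at this

theorem IsSomeCok.isNEpi {l : B ⟶ L} (h : IsSomeCok N l) : IsNEpi N l :=
  IsNMono.unop (f := l.op) h.op.isNMono

theorem IsNMono.of_comp {f : A ⟶ B} {g : B ⟶ X} (h : IsNMono N (f ≫ g)) : IsNMono N f :=
  fun x hx => h x (by rw [← Category.assoc]; exact null_comp_right N hx g)

theorem IsNEpi.of_comp {f : A ⟶ B} {g : B ⟶ X} (h : IsNEpi N (f ≫ g)) : IsNEpi N g :=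
  fun x hx => h x (by rw [Category.assoc]; exact null_comp_left N f hx)

theorem isNMono_of_isIso (f : A ⟶ B) [IsIso f] : IsNMono N f := fun x hx => by
  simpa using null_comp_right N hx (inv f)

theorem isNEpi_of_isIso (f : A ⟶ B) [IsIso f] : IsNEpi N f := fun x hx => by
  simpa using null_comp_left N (inv f) hx

/-- The left factor of a kernel through a monomorphism is a kernel. -/
theorem IsSomeKer.of_comp {k : K ⟶ X} {m : X ⟶ A} [Mono m] (h : IsSomeKer N (k ≫ m)) :
    IsSomeKer N k := by
  obtain ⟨B, f, h⟩ := h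
  have := h.mono
  have : Mono k := mono_of_mono k m
  refine ⟨B, m ≫ f, isKer_of_lift (by simpa using h.null) fun x hx => ?_⟩
  obtain ⟨y, hy⟩ := h.lift (x ≫ m) (by simpa using hx)
  exact ⟨y, by rwa [← Category.assoc, cancel_mono] at hy⟩

theorem IsSomeCok.of_comp {e : A ⟶ X} {l : X ⟶ L} [Epi e] (h : IsSomeCok N (e ≫ l)) :
    IsSomeCok N l := by
  have : IsSomeKer N.op (l.op ≫ e.op) := h.op
  exact (this.of_comp).unop

/-- An N-monomorphism does not change which composites are null, so both universal properties are
literally the same. -/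
theorem isKer_comp_nmono_iff {f : A ⟶ B} {m : B ⟶ X} (hm : IsNMono N m) {k : K ⟶ A} :
    IsKer N (f ≫ m) k ↔ IsKer N f k := by
  have e : ∀ {Y : C} (x : Y ⟶ A), N (x ≫ f ≫ m) ↔ N (x ≫ f) := fun x =>
    ⟨fun hx => hm _ (by rwa [Category.assoc]),
     fun hx => by rw [← Category.assoc]; exact null_comp_right N hx m⟩
  exact ⟨fun h => ⟨(e k).1 h.null, fun x hx => h.existsUnique_lift x ((e x).2 hx)⟩,
    fun h => ⟨(e k).2 h.null, fun x hx => h.existsUnique_lift x ((e x).1 hx)⟩⟩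

theorem isCok_nepi_comp_iff {e : X ⟶ A} {f : A ⟶ B} (he : IsNEpi N e) {l : B ⟶ L} :
    IsCok N (e ≫ f) l ↔ IsCok N f l := by
  have e : ∀ {Y : C} (x : B ⟶ Y), N ((e ≫ f) ≫ x) ↔ N (f ≫ x) := fun x =>
    ⟨fun hx => he _ (by rwa [← Category.assoc]),
     fun hx => by rw [Category.assoc]; exact null_comp_left N e hx⟩
  exact ⟨fun h => ⟨(e l).1 h.null, fun x hx => h.existsUnique_desc x ((e x).2 hx)⟩,
    fun h => ⟨(e l).2 h.null, fun x hx => h.existsUnique_desc x ((e x).1 hx)⟩⟩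

theorem IsKer.iso_comp {f : A ⟶ B} {k : K ⟶ A} (h : IsKer N f k) (e : X ⟶ K) [IsIso e] :
    IsKer N f (e ≫ k) := by
  have := h.mono
  refine isKer_of_lift (by rw [Category.assoc]; exact null_comp_left N e h.null) fun x hx => ?_
  obtain ⟨y, hy⟩ := h.lift x hx
  exact ⟨y ≫ inv e, by simpa using hy⟩

theorem IsCok.comp_iso {f : A ⟶ B} {l : B ⟶ L} (h : IsCok N f l) (e : L ⟶ X) [IsIso e] :
    IsCok N f (l ≫ e) := by
  have := h.epi
  refine isCok_of_desc (by rw [← Category.assoc]; exact null_comp_right N h.null e) fun x hx => ?_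
  obtain ⟨y, hy⟩ := h.desc x hx
  exact ⟨inv e ≫ y, by simpa using hy⟩

/-- Precomposing with an isomorphism transports kernels. -/
theorem IsKer.of_iso_comp {f : A ⟶ B} {e : X ⟶ A} [IsIso e] {k : K ⟶ X}
    (h : IsKer N f (k ≫ e)) : IsKer N (e ≫ f) k := by
  have := h.mono
  have : Mono k := mono_of_mono k e
  refine isKer_of_lift (by simpa using h.null) fun x hx => ?_
  obtain ⟨y, hy⟩ := h.lift (x ≫ e) (by simpa using hx)
  exact ⟨y, by rwa [← Category.assoc, cancel_mono] at hy⟩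

theorem IsCok.of_comp_iso {f : A ⟶ B} {e : B ⟶ X} [IsIso e] {l : X ⟶ L}
    (h : IsCok N f (e ≫ l)) : IsCok N (f ≫ e) l := by
  have : IsKer N.op f.op (l.op ≫ e.op) := h.op
  exact (this.of_iso_comp).unop

theorem IsCok.exists_iso {f : A ⟶ B} {l : B ⟶ L} {l' : B ⟶ X} (h : IsCok N f l)
    (h' : IsCok N f l') : ∃ e : L ⟶ X, IsIso e ∧ l ≫ e = l' := by
  obtain ⟨e, he⟩ := h.desc l' h'.null
  obtain ⟨e', he'⟩ := h'.desc l h.null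
  have := h.epi
  have := h'.epi
  refine ⟨e, ⟨e', ?_, ?_⟩, he⟩
  · rw [← cancel_epi l, ← Category.assoc, he, he', Category.comp_id]
  · rw [← cancel_epi l', ← Category.assoc, he', he, Category.comp_id]

theorem IsKer.exists_iso {f : A ⟶ B} {k : K ⟶ A} {k' : X ⟶ A} (h : IsKer N f k)
    (h' : IsKer N f k') : ∃ e : X ⟶ K, IsIso e ∧ e ≫ k = k' := by
  obtain ⟨e, he, h1⟩ := h.op.exists_iso h'.op
  exact ⟨e.unop, inferInstance, Quiver.Hom.op_inj h1⟩

theorem IsCok.isIso_of_comp {f : A ⟶ B} {l : B ⟶ L} {e : L ⟶ X} (h : IsCok N f l)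
    (h' : IsCok N f (l ≫ e)) : IsIso e := by
  obtain ⟨e', he, h1⟩ := h.exists_iso h'
  have := h.epi
  rw [cancel_epi] at h1
  rwa [← h1]

/-- A cokernel followed by a kernel is an exact morphism. -/
theorem isExactMor_of_fac {f : A ⟶ B} {p : A ⟶ X} {j : X ⟶ B} (hp : IsSomeCok N p)
    (hj : IsSomeKer N j) (e : p ≫ j = f) : IsExactMor N f := by
  -- As `j` is an N-monomorphism, `p` and `f` have the same kernel, so `p` is the coimage of `f`;
  -- dually `j` is its image.
  have hk : IsKer N p (ker N f) := by
    rw [← isKer_comp_nmono_iff hj.isNMono, e]; exact isKer_ker N f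
  have hl : IsCok N j (cok N f) := by
    rw [← isCok_nepi_comp_iff hp.isNEpi, e]; exact isCok_cok N f
  obtain ⟨s, hs, h1⟩ := (isCok_cok N (ker N f)).exists_iso (hp.isCok_of_isKer hk)
  obtain ⟨t, ht, h2⟩ := (isKer_ker N (cok N f)).exists_iso (hj.isKer_of_isCok hl)
  have : bar N f = s ≫ t := by
    rw [← cancel_epi (coim N f), ← cancel_mono (im N f), coim_bar, toIm_im]
    simp only [Category.assoc]
    rw [h2, ← Category.assoc, h1, e]
  unfold IsExactMor
  rw [this]
  infer_instance

theorem IsExactMor.isSomeCok_toIm {f : A ⟶ B} (h : IsExactMor N f) : IsSomeCok N (toIm N f) := by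
  have : IsIso (bar N f) := h
  rw [← coim_bar]
  exact ((isCok_cok N (ker N f)).comp_iso _).isSomeCok

theorem IsExactMor.isSomeKer_fromCoim {f : A ⟶ B} (h : IsExactMor N f) :
    IsSomeKer N (fromCoim N f) := by
  have : IsIso (bar N f) := h
  rw [← bar_im]
  exact ((isKer_ker N (cok N f)).iso_comp _).isSomeKer

theorem exactAt_of_forall {f : X ⟶ Y} {g : Y ⟶ Z} (hn : N (f ≫ g))
    (h : ∀ {W : C} (x : W ⟶ Y), N (x ≫ g) → N (x ≫ cok N f)) : ExactAt N f g :=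
  isKer_of_lift (null_im_comp N hn) fun x hx => (isKer_ker N (cok N f)).lift x (h x hx)

end Semiexact

/-! ### Consequences of the homological axioms: comparison of homologies, restriction of cokernels,
induced exact morphisms. -/

section Homological

variable {C : Type u} [Category.{v} C] {N : MorphismProperty C} [Homological N]

/-- If `f = l ≫ d` with `l` the coimage of `f`, then `d` is an `N`-monomorphism. -/
theorem isNMono_of_coim {A B K L : C} {f : A ⟶ B} {k : K ⟶ A} {l : A ⟶ L} {d : L ⟶ B}
    (hk : IsKer N f k) (hl : IsCok N k l) (e : l ≫ d = f) : IsNMono N d := by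
  have hk2 := isKer_ker N d
  have hc := isCok_cok N (ker N d)
  obtain ⟨d', hd'⟩ := hc.desc d hk2.null
  -- The composite of `l` with the cokernel of `ker d` is a cokernel of some `w`. Since `f` factors
  -- through it, `w` is killed by `f`, hence factors through `k` and is killed by `l`. So `l`
  -- factors through the composite, the cokernel of `ker d` has a retraction, and `ker d` is null.
  obtain ⟨U, w, hu⟩ := Homological.cok_comp _ _ hl.isSomeCok hc.isSomeCok
  have h1 : N (w ≫ f) := by
    rw [← e, ← hd']
    have := null_comp_right N hu.null d'
    simpa using this
  obtain ⟨w', rfl⟩ := hk.lift w h1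
  obtain ⟨s, hs⟩ := hu.desc l (by rw [Category.assoc]; exact null_comp_left N _ hl.null)
  have := hl.epi
  have hs' : cok N (ker N d) ≫ s = 𝟙 L := by
    rw [← cancel_epi l, ← Category.assoc, hs, Category.comp_id]
  have h2 : N (ker N d) := by
    have := null_comp_right N hc.null s
    rwa [Category.assoc, hs', Category.comp_id] at this
  intro X x hx
  obtain ⟨y, rfl⟩ := hk2.lift x hx
  exact null_comp_left N y h2

/-- If `f = d ≫ k` with `k` the image of `f`, then `d` is an `N`-epimorphism. -/
theorem isNEpi_of_im {A B K L : C} {f : A ⟶ B} {l : B ⟶ L} {k : K ⟶ B} {d : A ⟶ K}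
    (hl : IsCok N f l) (hk : IsKer N l k) (e : d ≫ k = f) : IsNEpi N d :=
  IsNMono.unop (f := d.op) (isNMono_of_coim hl.op hk.op (congrArg Quiver.Hom.op e))

/-- Comparison of the left and the right homology of the null sequence `f ≫ k`, `q ≫ g`. -/
theorem isCok_of_homology {X K Y Q Z J : C} {f : X ⟶ K} {k : K ⟶ Y} {q : Y ⟶ Q} {g : Q ⟶ Z}
    {j : J ⟶ Q} {r : K ⟶ J} (hk : IsKer N (q ≫ g) k) (hq : IsCok N (f ≫ k) q)
    (hj : IsKer N g j) (e : r ≫ j = k ≫ q) : IsCok N f r := by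
  have hl := isCok_cok N k
  have hk0 := isKer_ker N q
  obtain ⟨l', hl'⟩ := hq.desc (cok N k) (by
    rw [Category.assoc]; exact null_comp_left N _ hl.null)
  have hn : N (ker N q ≫ cok N k) := by
    rw [← hl', ← Category.assoc]; exact null_comp_right N hk0.null _
  -- It remains to identify `p` as a cokernel of `f` and `m` as a kernel of `g`.
  obtain ⟨H, p, m, hp, hm, epm⟩ := Homological.subquotient k q (ker N q) (cok N k)
    hk.isSomeKer hq.isSomeCok hk0 hl hn
  have := hp.epi
  have := hm.mono
  have := hj.mono
  have := hk.mono
  have := hq.epi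
  have hpf : IsCok N f p := by
    refine isCok_of_desc (hm.isNMono _ ?_) fun y hy => ?_
    · rw [Category.assoc, epm, ← Category.assoc]; exact hq.null
    have hk1 := isKer_ker N p
    refine (hp.isCok_of_isKer hk1).desc y ?_
    -- Kernels compose, so the kernel of `y` is a normal subobject of `Y`, the kernel of `w`. It
    -- contains `f ≫ k`, so `w` factors through `q`; this forces `ker p` into the kernel of `y`.
    obtain ⟨W, w, hw⟩ := Homological.ker_comp _ _ (isKer_ker N y).isSomeKer hk.isSomeKer
    obtain ⟨f'', rfl⟩ := (isKer_ker N y).lift f hy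
    obtain ⟨w', rfl⟩ := hq.desc w (by
      have := null_comp_left N f'' hw.null
      simpa using this)
    obtain ⟨s, hs⟩ := hw.lift (ker N p ≫ k) (by
      have := null_comp_right N hk1.null (m ≫ w')
      simp only [Category.assoc] at this ⊢
      rwa [← Category.assoc p, epm, Category.assoc] at this)
    rw [← Category.assoc, cancel_mono] at hs
    rw [← hs, Category.assoc]
    exact null_comp_left N s (isKer_ker N y).null
  -- The cokernel of `k` is the coimage of `q ≫ g`, so `g3` is an N-monomorphism and `g` kills
  -- exactly what `l'` kills.
  obtain ⟨g3, hg3⟩ := hl.desc (q ≫ g) hk.null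
  have hmono : IsNMono N g3 := isNMono_of_coim hk hl hg3
  have hg : l' ≫ g3 = g := by rw [← cancel_epi q, ← Category.assoc, hl', hg3]
  have hmg : IsKer N g m := by
    refine isKer_of_lift (hp.isNEpi _ ?_) fun z hz => ?_
    · rw [← Category.assoc, epm, Category.assoc]; exact hk.null
    have hlm := isCok_cok N m
    refine (hm.isKer_of_isCok hlm).lift z ?_
    obtain ⟨s, hs⟩ := hl.desc (q ≫ cok N m) (by
      rw [← Category.assoc, ← epm, Category.assoc]
      exact null_comp_left N _ hlm.null)
    have hs' : l' ≫ s = cok N m := by rw [← cancel_epi q, ← Category.assoc, hl', hs]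
    rw [← hs', ← Category.assoc]
    refine null_comp_right N (hmono _ ?_) s
    rwa [Category.assoc, hg]
  obtain ⟨t, ht, h1⟩ := hj.exists_iso hmg
  have : r = p ≫ t := by
    rw [← cancel_mono j, e, Category.assoc, h1, epm]
  rw [this]
  exact hpf.comp_iso t

theorem isKer_of_homology {X K Y Q Z L : C} {f : X ⟶ K} {k : K ⟶ Y} {q : Y ⟶ Q} {g : Q ⟶ Z}
    {p : K ⟶ L} {m : L ⟶ Q} (hk : IsKer N (q ≫ g) k) (hq : IsCok N (f ≫ k) q)
    (hp : IsCok N f p) (e : p ≫ m = k ≫ q) : IsKer N g m :=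
  (isCok_of_homology (f := g.op) (k := q.op) (q := k.op) (g := f.op) (j := p.op) (r := m.op)
    hq.op hk.op hp.op (congrArg Quiver.Hom.op e)).unop

/-- The restriction of a cokernel to an inverse image is a cokernel. -/
theorem isSomeCok_restrict {Y Q Z K J : C} {q : Y ⟶ Q} {w : Q ⟶ Z} {k : K ⟶ Y} {j : J ⟶ Q}
    {r : K ⟶ J} (hq : IsSomeCok N q) (hk : IsKer N (q ≫ w) k) (hj : IsKer N w j)
    (e : r ≫ j = k ≫ q) : IsSomeCok N r := by
  have hn := isKer_ker N q
  -- The kernel of `q` lies in `K`; the comparison is applied to this inclusion as the first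
  -- morphism of the sequence.
  obtain ⟨f, hf⟩ := hk.lift (ker N q) (by
    rw [← Category.assoc]; exact null_comp_right N hn.null w)
  refine (isCok_of_homology (f := f) hk ?_ hj e).isSomeCok
  rw [hf]
  exact hq.isCok_of_isKer hn

theorem isSomeKer_corestrict {X Y K L M : C} {w : X ⟶ K} {k : K ⟶ Y} {q : K ⟶ L} {p : Y ⟶ M}
    {r : L ⟶ M} (hk : IsSomeKer N k) (hp : IsCok N (w ≫ k) p) (hq : IsCok N w q)
    (e : q ≫ r = k ≫ p) : IsSomeKer N r :=
  (isSomeCok_restrict (q := k.op) (w := w.op) (k := p.op) (j := q.op) (r := r.op)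
    hk.op hp.op hq.op (congrArg Quiver.Hom.op e)).unop

/-- The morphism `Coker x ⟶ Coker (x ≫ p ≫ j)` induced by the exact morphism `p ≫ j` is exact. -/
theorem exists_fac_cokernels {X P R V L M K : C} {x : X ⟶ P} {p : P ⟶ R} {j : R ⟶ V} {k : K ⟶ P}
    {l : P ⟶ L} {m : V ⟶ M} {d : L ⟶ M} (hp : IsSomeCok N p) (hj : IsSomeKer N j)
    (hk : IsKer N p k) (hl : IsCok N x l) (hm : IsCok N (x ≫ p ≫ j) m)
    (e : l ≫ d = (p ≫ j) ≫ m) :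
    ∃ (I : C) (d₁ : L ⟶ I) (d₂ : I ⟶ M), IsCok N (k ≫ l) d₁ ∧ IsSomeKer N d₂ ∧ d₁ ≫ d₂ = d := by
  have hy := isCok_cok N (x ≫ p)
  have hpk := hp.isCok_of_isKer hk
  have := hp.epi
  have := hl.epi
  have := hy.epi
  obtain ⟨d₁, h₁⟩ := hl.desc (p ≫ cok N (x ≫ p)) (by simpa using hy.null)
  obtain ⟨d₂, h₂⟩ := hy.desc (j ≫ m) (by simpa using hm.null)
  refine ⟨_, d₁, d₂, ?_, ?_, ?_⟩
  · have : Epi (l ≫ d₁) := by rw [h₁]; infer_instance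
    have : Epi d₁ := epi_of_epi l d₁
    refine isCok_of_desc ?_ fun w hw => ?_
    · rw [Category.assoc, h₁, ← Category.assoc]
      exact null_comp_right N hk.null _
    · obtain ⟨w', hw'⟩ := hpk.desc (l ≫ w) (by simpa using hw)
      obtain ⟨w'', hw''⟩ := hy.desc w' (by
        rw [Category.assoc, hw', ← Category.assoc]
        exact null_comp_right N hl.null w)
      refine ⟨w'', ?_⟩
      rw [← cancel_epi l, ← Category.assoc, h₁, Category.assoc, hw'', hw']
  -- The kernel `j` stays a kernel after passing to the quotients by the image of `x`.
  · exact isSomeKer_corestrict hj (by simpa using hm) hy h₂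
  · rw [← cancel_epi l, ← Category.assoc, h₁, Category.assoc, h₂, e, Category.assoc]

theorem exists_fac_kernels {X P R V L M K : C} {x : P ⟶ X} {p : V ⟶ R} {j : R ⟶ P} {k : P ⟶ K}
    {l : L ⟶ P} {m : M ⟶ V} {d : M ⟶ L} (hp : IsSomeCok N p) (hj : IsSomeKer N j)
    (hk : IsCok N j k) (hl : IsKer N x l) (hm : IsKer N ((p ≫ j) ≫ x) m)
    (e : d ≫ l = m ≫ p ≫ j) :
    ∃ (I : C) (d₁ : M ⟶ I) (d₂ : I ⟶ L), IsSomeCok N d₁ ∧ IsKer N (l ≫ k) d₂ ∧ d₁ ≫ d₂ = d := by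
  obtain ⟨I, d₂, d₁, h₂, h₁, h⟩ := exists_fac_cokernels (x := x.op) (p := j.op) (j := p.op)
    (k := k.op) (l := l.op) (m := m.op) (d := d.op) hj.op hp.op hk.op hl.op hm.op
    (congrArg Quiver.Hom.op e)
  exact ⟨I.unop, d₁.unop, d₂.unop, h₁.unop, h₂.unop, Quiver.Hom.op_inj h⟩

end Homological

/-! ### Pushouts of cokernels, the right homology, and image factorizations. -/

section Auxiliary

variable {C : Type u} [Category.{v} C] {N : MorphismProperty C}

section

variable [Semiexact N]

/-- The pushout of two cokernels, seen from the second one. -/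
theorem isCok_of_pushout {A K₁ K₂ L₁ L₂ P : C} {k₁ : K₁ ⟶ A} {k₂ : K₂ ⟶ A} {l₁ : A ⟶ L₁}
    {l₂ : A ⟶ L₂} {r₁ : L₁ ⟶ P} {r₂ : L₂ ⟶ P} (h₁ : IsCok N k₁ l₁) (h₂ : IsCok N k₂ l₂)
    (hr : IsCok N (k₂ ≫ l₁) r₁) (e : l₂ ≫ r₂ = l₁ ≫ r₁) : IsCok N (k₁ ≫ l₂) r₂ := by
  have := h₁.epi
  have := h₂.epi
  have := hr.epi
  have : Epi (l₂ ≫ r₂) := by rw [e]; infer_instance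
  have : Epi r₂ := epi_of_epi l₂ r₂
  refine isCok_of_desc ?_ fun w hw => ?_
  · rw [Category.assoc, e, ← Category.assoc]
    exact null_comp_right N h₁.null r₁
  · obtain ⟨w₁, e₁⟩ := h₁.desc (l₂ ≫ w) (by simpa using hw)
    obtain ⟨w₂, e₂⟩ := hr.desc w₁ (by
      rw [Category.assoc, e₁, ← Category.assoc]
      exact null_comp_right N h₂.null w)
    refine ⟨w₂, ?_⟩
    rw [← cancel_epi l₂, ← Category.assoc, e, Category.assoc, e₂, e₁]

theorem isKer_of_pullback {B K₁ K₂ L₁ L₂ P : C} {l₁ : B ⟶ L₁} {l₂ : B ⟶ L₂} {k₁ : K₁ ⟶ B}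
    {k₂ : K₂ ⟶ B} {r₁ : P ⟶ K₁} {r₂ : P ⟶ K₂} (h₁ : IsKer N l₁ k₁) (h₂ : IsKer N l₂ k₂)
    (hr : IsKer N (k₁ ≫ l₂) r₁) (e : r₂ ≫ k₂ = r₁ ≫ k₁) : IsKer N (k₂ ≫ l₁) r₂ :=
  (isCok_of_pushout (r₂ := r₂.op) h₁.op h₂.op hr.op (congrArg Quiver.Hom.op e)).unop

end

variable [Homological N]

/-- This is what lets the homology, constructed as a cokernel, also serve as a subobject of the
cokernel of `f`. -/
theorem isKer_homι {X Y Z : C} (f : X ⟶ Y) (g : Y ⟶ Z) (w : N (f ≫ g)) :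
    IsKer N (fromOpcycles N f g w) (homι N f g w) :=
  isKer_of_homology (f := toCycles N f g w) (k := ker N g) (q := cok N f) (p := homπ N f g w)
    (by rw [cok_fromOpcycles]; exact isKer_ker N g)
    (by rw [toCycles_ker]; exact isCok_cok N f) (isCok_cok N _) (homπ_homι N f g w)

theorem isNEpi_toIm {A B : C} (f : A ⟶ B) : IsNEpi N (toIm N f) :=
  isNEpi_of_im (isCok_cok N f) (isKer_ker N _) (toIm_im N f)

theorem isNMono_fromCoim {A B : C} (f : A ⟶ B) : IsNMono N (fromCoim N f) :=
  isNMono_of_coim (isKer_ker N f) (isCok_cok N _) (coim_fromCoim N f)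

end Auxiliary

/-! ### Comparison isomorphisms, construction of the sequence, uniqueness and nullity. -/

namespace Diagram

variable {C : Type u} [Category.{v} C] {N : MorphismProperty C} [Homological N] (D : Diagram N)
  (hb : IsExactMor N D.b)

/-! Lambek morphisms that are isomorphisms. -/

/-- The two hypotheses say that Im S and Ker T are the left and the right homology of the null
sequence A → Im b → C', with Im b and Coim b identified through `bar`. -/
theorem isIso_lambek (hk : IsKer N (im N D.b ≫ D.g') (sqL N D.S))
    (hq : IsCok N (D.f ≫ coim N D.b) (sqR N D.T)) : IsIso (D.lambek hb) := by
  have : IsIso (bar N D.b) := hb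
  have hq' : IsCok N ((D.f ≫ coim N D.b) ≫ bar N D.b) (inv (bar N D.b) ≫ sqR N D.T) :=
    IsCok.of_comp_iso (by simpa using hq)
  refine (isCok_cok N (sqLam N D.S)).isIso_of_comp (isCok_of_homology (k := sqL N D.S)
    (q := inv (bar N D.b) ≫ sqR N D.T) (g := sqRho N D.T) (j := sqKerι N D.T) ?_ ?_
    (isKer_ker N _) ?_)
  · rw [Category.assoc, sqR_sqRho, ← bar_im]
    simp only [Category.assoc, IsIso.inv_hom_id_assoc]
    exact hk
  · rw [sqLam_sqL]
    simpa using hq'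
  · rw [Category.assoc]
    exact D.lambek_spec hb

/-- The Lambek morphism `Λ : Im S ⟶ Ker S₁`. -/
noncomputable def lambekSS₁ : sqIm N D.S ⟶ sqKer N D.S₁ := D.SS₁.lambek hb

/-- The Lambek morphism `Λ : Im T₁ ⟶ Ker T`. -/
noncomputable def lambekT₁T : sqIm N D.T₁ ⟶ sqKer N D.T := D.T₁T.lambek hb

theorem lambekSS₁_spec :
    have : IsIso (bar N D.b) := hb
    sqImπ N D.S ≫ D.lambekSS₁ hb ≫ sqKerι N D.S₁ =
      sqL N D.S ≫ inv (bar N D.b) ≫ sqR N D.S₁ := D.SS₁.lambek_spec hb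

theorem lambekT₁T_spec :
    have : IsIso (bar N D.b) := hb
    sqImπ N D.T₁ ≫ D.lambekT₁T hb ≫ sqKerι N D.T =
      sqL N D.T₁ ≫ inv (bar N D.b) ≫ sqR N D.T := D.T₁T.lambek_spec hb

/-- The kernel condition holds by definition because the lower second row is `cok f'`. For the
cokernel condition, A → Im f is an N-epimorphism, so `f` and `im f` give the same quotient of Coim
b. -/
instance isIso_lambekSS₁ : IsIso (D.lambekSS₁ hb) := by
  refine D.SS₁.isIso_lambek hb (isKer_ker N _) ?_
  change IsCok N (D.f ≫ coim N D.b) (cok N (im N D.f ≫ coim N D.b))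
  have := (isCok_nepi_comp_iff (isNEpi_toIm (N := N) D.f)).2
    (isCok_cok N (im N D.f ≫ coim N D.b))
  rwa [toIm_im_assoc] at this

instance isIso_lambekT₁T : IsIso (D.lambekT₁T hb) := by
  refine D.T₁T.isIso_lambek hb ?_ (isCok_cok N _)
  change IsKer N (im N D.b ≫ D.g') (ker N (im N D.b ≫ coim N D.g'))
  have := (isKer_comp_nmono_iff (isNMono_fromCoim (N := N) D.g')).2
    (isKer_ker N (im N D.b ≫ coim N D.g'))
  rwa [Category.assoc, coim_fromCoim] at this

/-- The pushout attached to S₁, read from the side of Coker f instead of Coim b. -/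
theorem isCok_phi : IsCok N (ker N D.b ≫ cok N D.f) D.phi :=
  isCok_of_pushout (k₂ := im N D.f) (isCok_cok N (ker N D.b))
    ((isCok_cok N D.f).isCok_of_isKer (isKer_ker N _)) (isCok_cok N _) D.cok_phi

theorem isKer_phi' : IsKer N (ker N D.g' ≫ cok N D.b) D.phi' :=
  isKer_of_pullback (l₂ := coim N D.g') (isKer_ker N (cok N D.b))
    ((isKer_ker N D.g').isKer_of_isCok (isCok_cok N _)) (isKer_ker N _) D.phi'_ker

/-- Source and target are the left and the right homology of the null sequence Ker b → Coker f →
Coker f'. -/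
instance isIso_lambekCol : IsIso D.lambekCol := by
  refine (isCok_cok N D.xi).isIso_of_comp (isCok_of_homology (k := ker N D.bCheck)
    (q := D.phi) (g := sqRho N D.S₁) (j := sqKerι N D.S₁) ?_ ?_ (isKer_ker N _) ?_)
  · rw [phi_sqRho]; exact isKer_ker N _
  · rw [xi_ker]; exact D.isCok_phi
  · rw [Category.assoc]; exact D.lambekCol_spec

instance isIso_lambekCol' : IsIso D.lambekCol' := by
  refine (isCok_cok N (sqLam N D.T₁)).isIso_of_comp (isCok_of_homology (k := D.phi')
    (q := cok N D.bHat) (g := D.xi') (j := ker N D.xi') ?_ ?_ (isKer_ker N _) ?_)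
  · rw [cok_xi']; exact D.isKer_phi'
  · rw [sqLam_phi']; exact isCok_cok N _
  · rw [Category.assoc]; exact D.lambekCol'_spec

/-- Both objects are the part of Coker f that dies in C and in Coker f'. The upper `homι` being a
kernel lifts Ker η to H, and the lower one being an N-monomorphism puts the lift into Ker h. -/
instance isIso_theta : IsIso D.theta := by
  have h1 := isKer_homι D.f D.g D.null
  have h2 := isKer_homι D.f' D.g' D.null'
  have := h1.mono
  obtain ⟨z, hz⟩ := h1.lift (ker N D.eta ≫ ker N D.bCheck) (by
    rw [Category.assoc, ← eta_ker, ← Category.assoc]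
    exact null_comp_right N (null_ker N _) _)
  obtain ⟨t, ht⟩ := (isKer_ker N D.h).lift z (by
    refine h2.isSomeKer.isNMono _ ?_
    rw [Category.assoc, h_homι, ← Category.assoc, hz, Category.assoc]
    exact null_comp_left N _ (null_ker N _))
  refine ⟨t, ?_, ?_⟩
  · rw [← cancel_mono (ker N D.h), ← cancel_mono (homι N D.f D.g D.null)]
    simp only [Category.assoc, Category.id_comp]
    rw [← Category.assoc t, ht, hz, theta_spec]
  · rw [← cancel_mono (ker N D.eta ≫ ker N D.bCheck)]
    simp only [Category.assoc, Category.id_comp]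
    rw [theta_spec, ← Category.assoc, ht, hz]

/-- Both objects are the quotient of Ker g' by the images of A' and Ker g. As the homology is built
as a cokernel, no comparison is needed here. -/
instance isIso_theta' : IsIso D.theta' := by
  have h1 := isCok_cok N (toCycles N D.f D.g D.null)
  have h2 := isCok_cok N (toCycles N D.f' D.g' D.null')
  obtain ⟨z, hz⟩ := h2.desc (cok N D.bHat ≫ cok N D.eta') (by
    rw [← Category.assoc, ← cok_eta', Category.assoc]
    exact null_comp_left N _ (null_cok N _))
  obtain ⟨t, ht⟩ := (isCok_cok N D.h).desc z (by
    refine h1.isSomeCok.isNEpi _ ?_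
    rw [← Category.assoc, homπ_h, Category.assoc, hz, ← Category.assoc]
    exact null_comp_right N (null_cok N _) _)
  refine ⟨t, ?_, ?_⟩
  · rw [← cancel_epi (cok N D.bHat ≫ cok N D.eta')]
    have := D.theta'_spec
    simp only [Category.assoc, Category.comp_id]
    rw [← Category.assoc (cok N D.eta'), ← Category.assoc (cok N D.bHat), this, Category.assoc,
      ht, hz]
  · rw [← cancel_epi (cok N D.h), ← cancel_epi (homπ N D.f' D.g' D.null')]
    simp only [Category.comp_id]
    rw [← Category.assoc (cok N D.h), ht, ← Category.assoc, hz, Category.assoc, theta'_spec]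

/-! The identifications of `Im S` with `Coker ξ` and of `Ker T` with `Ker ξ'`. -/

/-- The cokernel `Ker bCheck ⟶ Im S` of `ξ`. -/
noncomputable def omega : kerObj N D.bCheck ⟶ sqIm N D.S :=
  cok N D.xi ≫ D.lambekCol ≫ inv (D.lambekSS₁ hb)

theorem omega_lambekSS₁ : D.omega hb ≫ D.lambekSS₁ hb = cok N D.xi ≫ D.lambekCol := by
  simp [omega]

theorem isCok_omega : IsCok N D.xi (D.omega hb) :=
  (isCok_cok N D.xi).comp_iso (D.lambekCol ≫ inv (D.lambekSS₁ hb))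

/-- The kernel `Ker T ⟶ Coker bHat` of `ξ'`. -/
noncomputable def omega' : sqKer N D.T ⟶ cokObj N D.bHat :=
  (inv (D.lambekT₁T hb) ≫ D.lambekCol') ≫ ker N D.xi'

theorem lambekT₁T_omega' : D.lambekT₁T hb ≫ D.omega' hb = D.lambekCol' ≫ ker N D.xi' := by
  simp [omega']

theorem isKer_omega' : IsKer N D.xi' (D.omega' hb) :=
  (isKer_ker N D.xi').iso_comp (inv (D.lambekT₁T hb) ≫ D.lambekCol')

/-- The canonical morphism `Coker f ⟶ Coim g`. -/
noncomputable def opcyclesToCoim : cokObj N D.f ⟶ coimObj N D.g :=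
  cokDesc N D.f (coim N D.g) (null_comp_coim N D.null)

@[simp]
theorem cok_opcyclesToCoim : cok N D.f ≫ D.opcyclesToCoim = coim N D.g := cok_cokDesc N _ _ _

theorem opcyclesToCoim_fromCoim :
    D.opcyclesToCoim ≫ fromCoim N D.g = fromOpcycles N D.f D.g D.null := by
  rw [← cancel_epi (cok N D.f), ← Category.assoc, cok_opcyclesToCoim, coim_fromCoim,
    cok_fromOpcycles]

theorem null_homι_opcyclesToCoim : N (homι N D.f D.g D.null ≫ D.opcyclesToCoim) := by
  refine isNEpi_cok N (toCycles N D.f D.g D.null) _ ?_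
  change N (homπ N D.f D.g D.null ≫ homι N D.f D.g D.null ≫ D.opcyclesToCoim)
  rw [← Category.assoc, homπ_homι, Category.assoc, cok_opcyclesToCoim]
  exact null_cok N _

/-- The canonical morphism `Im f' ⟶ Ker g'`. -/
noncomputable def imToCycles : imObj N D.f' ⟶ kerObj N D.g' :=
  kerLift N D.g' (im N D.f') (null_im_comp N D.null')

@[simp]
theorem imToCycles_ker : D.imToCycles ≫ ker N D.g' = im N D.f' := kerLift_ker N _ _ _

theorem toIm_imToCycles :
    toIm N D.f' ≫ D.imToCycles = toCycles N D.f' D.g' D.null' := by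
  rw [← cancel_mono (ker N D.g'), Category.assoc, imToCycles_ker, toIm_im, toCycles_ker]

theorem null_imToCycles_homπ : N (D.imToCycles ≫ homπ N D.f' D.g' D.null') := by
  refine (isKer_homι D.f' D.g' D.null').isSomeKer.isNMono _ ?_
  rw [Category.assoc, homπ_homι, ← Category.assoc, imToCycles_ker]
  exact null_ker N _

/-- Seen from Ker b̌, the Lambek morphism is induced by Coker f → Coim g. Both the nullity of β
followed by Λ and the factorization of Λ are read off from this form. -/
theorem omega_lambek : D.omega hb ≫ D.lambek hb ≫ sqKerι N D.T =
    ker N D.bCheck ≫ D.opcyclesToCoim ≫ sqR' N D.T := by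
  have : IsIso (bar N D.b) := hb
  -- As Im f lies in Ker g, the pushout for T is a further quotient of the pushout for S₁.
  obtain ⟨r, hr⟩ : ∃ r : sqP N D.S₁ ⟶ sqP N D.T, sqR N D.S₁ ≫ r = sqR N D.T := by
    refine (isCok_cok N _).desc _ ?_
    have h := null_cok N (ker N D.g ≫ coim N D.b)
    have := null_comp_left N (kerLift N D.g (im N D.f) (null_im_comp N D.null)) h
    simpa only [Category.assoc, kerLift_ker_assoc] using this
  have h1 : D.lambek hb ≫ sqKerι N D.T = D.lambekSS₁ hb ≫ sqKerι N D.S₁ ≫ r := by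
    rw [← cancel_epi (sqImπ N D.S), D.lambek_spec hb, ← hr]
    have := D.lambekSS₁_spec hb
    have := congrArg (· ≫ r) this
    simp only [Category.assoc] at this
    exact this.symm
  have h2 : D.phi ≫ r = D.opcyclesToCoim ≫ sqR' N D.T := by
    rw [← cancel_epi (cok N D.f), ← Category.assoc, cok_phi, Category.assoc, hr,
      ← Category.assoc, cok_opcyclesToCoim]
    exact (sq_isPushout N D.T).w
  rw [h1, ← h2]
  have := congrArg (· ≫ sqKerι N D.S₁ ≫ r) (D.omega_lambekSS₁ hb)
  simp only [Category.assoc] at this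
  refine this.trans ?_
  have := congrArg (· ≫ r) D.lambekCol_spec
  simpa only [Category.assoc] using this

theorem lambek_omega' : sqImπ N D.S ≫ D.lambek hb ≫ D.omega' hb =
    sqL' N D.S ≫ D.imToCycles ≫ cok N D.bHat := by
  have : IsIso (bar N D.b) := hb
  -- Dually, Im f' lies in Ker g', so one pullback is contained in the other.
  obtain ⟨r, hr⟩ : ∃ r : sqM N D.S ⟶ sqM N D.T₁, r ≫ sqL N D.T₁ = sqL N D.S := by
    refine (isKer_ker N _).lift _ ?_
    rw [← Category.assoc, (sq_isPullback N D.S).w, Category.assoc]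
    exact null_comp_left N _ (null_im_comp N (null_comp_coim N D.null'))
  have h1 : sqImπ N D.S ≫ D.lambek hb = r ≫ sqImπ N D.T₁ ≫ D.lambekT₁T hb := by
    rw [← cancel_mono (sqKerι N D.T)]
    simp only [Category.assoc]
    rw [D.lambek_spec hb, ← hr, Category.assoc]
    congr 1
    exact (D.lambekT₁T_spec hb).symm
  have h2 : r ≫ D.phi' = sqL' N D.S ≫ D.imToCycles := by
    rw [← cancel_mono (ker N D.g'), Category.assoc, phi'_ker, ← Category.assoc, hr,
      Category.assoc, imToCycles_ker]
    exact (sq_isPullback N D.S).w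
  have e1 := congrArg (· ≫ D.omega' hb) h1
  have e2 := congrArg (fun t => r ≫ sqImπ N D.T₁ ≫ t) (D.lambekT₁T_omega' hb)
  have e3 := congrArg (r ≫ ·) D.lambekCol'_spec
  have e4 := congrArg (· ≫ cok N D.bHat) h2
  simp only [Category.assoc] at e1 e2 e3 e4
  exact e1.trans (e2.trans (e3.trans e4))

theorem v_ker : D.v ≫ ker N D.eta = ker N (D.xi ≫ D.eta) ≫ D.xi := kerLift_ker N _ _ _

theorem cok_v' : cok N D.eta' ≫ D.v' = D.xi' ≫ cok N (D.eta' ≫ D.xi') := cok_cokDesc N _ _ _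

theorem nonempty_nomuraMaps : Nonempty (D.NomuraMaps hb) := by
  obtain ⟨α₀, hα₀⟩ := (isCok_cok N (toCycles N D.k (D.xi ≫ D.eta) D.null_k)).desc D.v (by
    refine isNMono_ker N D.eta _ (isNMono_ker N D.bCheck _ ?_)
    simp only [Category.assoc]
    rw [← Category.assoc D.v, v_ker, Category.assoc, xi_ker, ← Category.assoc, toCycles_ker,
      ← Category.assoc, k_ker, Category.assoc]
    exact null_comp_left N _ (null_cok N _))
  -- Here the homology has to be used as a kernel, whereas α came from its description as a
  -- cokernel.
  obtain ⟨α₀', hα₀'⟩ := (isKer_homι (D.eta' ≫ D.xi') D.k' D.null_k').lift D.v' (by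
    refine isNEpi_cok N D.eta' _ (isNEpi_cok N D.bHat _ ?_)
    rw [← Category.assoc (cok N D.eta'), cok_v', Category.assoc, cok_fromOpcycles,
      ← Category.assoc, cok_xi', Category.assoc, cok_k', ← Category.assoc]
    exact null_comp_right N (null_ker N _) _)
  exact ⟨{
    α := α₀ ≫ inv D.theta
    β := D.theta ≫ ker N D.eta ≫ D.omega hb
    β' := D.omega' hb ≫ cok N D.eta' ≫ D.theta'
    α' := inv D.theta' ≫ α₀'
    α_eq := by simpa using hα₀
    β_eq := ((Category.assoc _ _ _).trans (congrArg (D.theta ≫ ·) (Category.assoc _ _ _))).trans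
      (congrArg (fun t => D.theta ≫ ker N D.eta ≫ t) (D.omega_lambekSS₁ hb))
    β'_eq := by
      have := congrArg (· ≫ cok N D.eta' ≫ D.theta') (D.lambekT₁T_omega' hb)
      simp only [Category.assoc] at this
      exact this
    α'_eq := by simpa using hα₀' }⟩

namespace NomuraMaps

variable {D hb} (n : D.NomuraMaps hb)

theorem β_eq_omega : n.β = D.theta ≫ ker N D.eta ≫ D.omega hb := by
  have e : n.β ≫ D.lambekSS₁ hb = D.theta ≫ ker N D.eta ≫ cok N D.xi ≫ D.lambekCol := n.β_eq
  rw [← D.omega_lambekSS₁ hb] at e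
  simpa only [← Category.assoc, cancel_mono] using e

theorem β'_eq_omega' : n.β' = D.omega' hb ≫ cok N D.eta' ≫ D.theta' := by
  have e : D.lambekT₁T hb ≫ n.β' = D.lambekCol' ≫ ker N D.xi' ≫ cok N D.eta' ≫ D.theta' :=
    n.β'_eq
  rw [← cancel_epi (D.lambekT₁T hb), e]
  simp only [← Category.assoc, lambekT₁T_omega']

theorem unique (n n' : D.NomuraMaps hb) : n = n' := by
  have := (isKer_homι (D.eta' ≫ D.xi') D.k' D.null_k').mono
  ext
  · have h := n.α_eq.trans n'.α_eq.symm
    rwa [cancel_epi, cancel_mono] at h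
  · rw [n.β_eq_omega, n'.β_eq_omega]
  · rw [n.β'_eq_omega', n'.β'_eq_omega']
  · have h := n.α'_eq.trans n'.α'_eq.symm
    rwa [cancel_epi, cancel_mono] at h

theorem null_α_β : N (n.α ≫ n.β) := by
  refine isNEpi_cok N (toCycles N D.k (D.xi ≫ D.eta) D.null_k) _ ?_
  have e := congrArg (· ≫ ker N D.eta ≫ D.omega hb) n.α_eq
  simp only [Category.assoc] at e
  rw [n.β_eq_omega, e, ← Category.assoc, v_ker, Category.assoc]
  exact null_comp_left N _ (D.isCok_omega hb).null

/-- The composite passes through H → Coker f → Coim g, which is null. -/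
theorem null_β_lambek : N (n.β ≫ D.lambek hb) := by
  refine isNMono_ker N (sqRho N D.T) _ ?_
  rw [n.β_eq_omega]
  simp only [Category.assoc]
  have e := D.omega_lambek hb
  have e' := congrArg (· ≫ D.opcyclesToCoim ≫ sqR' N D.T) D.theta_spec
  simp only [Category.assoc] at e'
  rw [e, e']
  refine null_comp_left N _ ?_
  rw [← Category.assoc]
  exact null_comp_right N D.null_homι_opcyclesToCoim _

/-- The composite passes through Im f' → Ker g' → H', which is null. -/
theorem null_lambek_β' : N (D.lambek hb ≫ n.β') := by
  refine isNEpi_cok N (sqLam N D.S) _ ?_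
  rw [n.β'_eq_omega']
  have e := congrArg (· ≫ cok N D.eta' ≫ D.theta') (D.lambek_omega' hb)
  simp only [Category.assoc] at e
  rw [e, theta'_spec]
  refine null_comp_left N _ ?_
  rw [← Category.assoc]
  exact null_comp_right N D.null_imToCycles_homπ _

theorem null_β'_α' : N (n.β' ≫ n.α') := by
  refine (isKer_homι (D.eta' ≫ D.xi') D.k' D.null_k').isSomeKer.isNMono _ ?_
  rw [n.β'_eq_omega']
  simp only [Category.assoc]
  rw [n.α'_eq, cok_v', ← Category.assoc]
  exact null_comp_right N (D.isKer_omega' hb).null _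

end NomuraMaps

end Diagram

/-! ### Exactness of the sequence. -/

namespace Diagram

variable {C : Type u} [Category.{v} C] {N : MorphismProperty C} [Homological N] (D : Diagram N)
  (hb : IsExactMor N D.b)

/-! Exactness at `Ker h`. -/

/-- The morphism `Ker (ηξ) ⟶ Coker f`. -/
noncomputable def mu : kerObj N (D.xi ≫ D.eta) ⟶ cokObj N D.f :=
  ker N (D.xi ≫ D.eta) ≫ ker N D.b ≫ cok N D.f

theorem v_mu : D.v ≫ ker N D.eta ≫ ker N D.bCheck = D.mu := by
  rw [← Category.assoc, v_ker, Category.assoc, xi_ker, mu]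

/-- Exactness of `f` makes Ker(bf) → Ker μ a cokernel, hence an N-epimorphism, so dividing Ker(ηξ)
by Ker(bf) is dividing it by Ker μ: the canonical π is the coimage of μ. -/
theorem isCok_ker_mu (hf : IsExactMor N D.f) :
    IsCok N (ker N D.mu) (homπ N D.k (D.xi ≫ D.eta) D.null_k) := by
  have hμ := null_ker N D.mu
  obtain ⟨z, hz⟩ := (isKer_ker N (cok N D.f)).lift
    (ker N D.mu ≫ ker N (D.xi ≫ D.eta) ≫ ker N D.b) (by simpa [mu] using hμ)
  -- Ker μ is the intersection of Im f and Ker b; the condition of lying in Ker(ηξ) is automatic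
  -- because `f ≫ g` is null.
  have hzk : IsKer N (im N D.f ≫ D.b) z := by
    have : Mono (z ≫ im N D.f) := by rw [hz]; infer_instance
    have : Mono z := mono_of_mono z (im N D.f)
    refine isKer_of_lift ?_ fun x hx => ?_
    · rw [← Category.assoc, hz]
      simp only [Category.assoc]
      exact null_comp_left N _ (null_comp_left N _ (null_ker N _))
    · obtain ⟨x₁, h₁⟩ := (isKer_ker N D.b).lift (x ≫ im N D.f) (by simpa using hx)
      obtain ⟨x₂, h₂⟩ := (isKer_ker N (D.xi ≫ D.eta)).lift x₁ (by
        refine isNMono_ker N D.c _ ?_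
        rw [Category.assoc, xi_eta_ker, ← Category.assoc, h₁, Category.assoc]
        exact null_comp_left N _ (null_im_comp N D.null))
      obtain ⟨x₃, h₃⟩ := (isKer_ker N D.mu).lift x₂ (by
        rw [mu, ← Category.assoc, h₂, ← Category.assoc, h₁, Category.assoc]
        exact null_comp_left N _ (null_ker N _))
      refine ⟨x₃, ?_⟩
      rw [← cancel_mono (im N D.f), Category.assoc, hz, ← Category.assoc, h₃, ← Category.assoc,
        h₂, h₁]
  obtain ⟨e, he⟩ := (isKer_ker N D.mu).lift (toCycles N D.k (D.xi ≫ D.eta) D.null_k) (by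
    rw [mu, ← Category.assoc, toCycles_ker, ← Category.assoc, k_ker, Category.assoc]
    exact null_comp_left N _ (null_cok N _))
  -- `e` is the restriction of the cokernel A → Im f to the inverse image of Ker b.
  have hes : IsSomeCok N e := by
    refine isSomeCok_restrict (k := ker N (D.f ≫ D.b)) hf.isSomeCok_toIm ?_ hzk ?_
    · rw [toIm_im_assoc]; exact isKer_ker N _
    · rw [← cancel_mono (im N D.f), Category.assoc, hz, ← Category.assoc, he, ← Category.assoc,
        toCycles_ker, k_ker, Category.assoc, toIm_im]
  have := isCok_cok N (toCycles N D.k (D.xi ≫ D.eta) D.null_k)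
  rw [← he, isCok_nepi_comp_iff hes.isNEpi, he] at this
  exact this

/-- The morphism `Ker g' ⟶ Coker (ξ'η')`. -/
noncomputable def mu' : kerObj N D.g' ⟶ cokObj N (D.eta' ≫ D.xi') :=
  (ker N D.g' ≫ cok N D.b) ≫ cok N (D.eta' ≫ D.xi')

theorem mu'_v' : cok N D.bHat ≫ cok N D.eta' ≫ D.v' = D.mu' := by
  rw [cok_v', ← Category.assoc, cok_xi', mu']

/-- Dual to `isCok_ker_mu`: exactness of `g'` makes Coker μ' → Coker(g'b) a kernel, so the canonical
ι is the image of μ'. -/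
theorem isKer_cok_mu' (hg' : IsExactMor N D.g') :
    IsKer N (cok N D.mu') (homι N (D.eta' ≫ D.xi') D.k' D.null_k') := by
  have hμ := null_cok N D.mu'
  obtain ⟨z, hz⟩ := (isCok_cok N (ker N D.g')).desc
    (cok N D.b ≫ cok N (D.eta' ≫ D.xi') ≫ cok N D.mu') (by simpa [mu'] using hμ)
  have hzk : IsCok N (D.b ≫ coim N D.g') z := by
    have : Epi (coim N D.g' ≫ z) := by rw [hz]; infer_instance
    have : Epi z := epi_of_epi (coim N D.g') z
    refine isCok_of_desc ?_ fun x hx => ?_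
    · rw [Category.assoc, hz, ← Category.assoc]
      exact null_comp_right N (null_cok N _) _
    · obtain ⟨x₁, h₁⟩ := (isCok_cok N D.b).desc (coim N D.g' ≫ x) (by simpa using hx)
      obtain ⟨x₂, h₂⟩ := (isCok_cok N (D.eta' ≫ D.xi')).desc x₁ (by
        refine isNEpi_cok N D.a _ ?_
        have e := D.cok_eta'_xi'
        rw [← Category.assoc, e, Category.assoc, h₁, ← Category.assoc]
        exact null_comp_right N (null_comp_coim N D.null') _)
      obtain ⟨x₃, h₃⟩ := (isCok_cok N D.mu').desc x₂ (by
        rw [mu', Category.assoc, h₂, Category.assoc, h₁, ← Category.assoc]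
        exact null_comp_right N (null_cok N _) _)
      refine ⟨x₃, ?_⟩
      rw [← cancel_epi (coim N D.g'), ← Category.assoc, hz, Category.assoc, Category.assoc, h₃,
        h₂, h₁]
  obtain ⟨e, he⟩ := (isCok_cok N D.mu').desc (fromOpcycles N (D.eta' ≫ D.xi') D.k' D.null_k') (by
    rw [mu', Category.assoc, cok_fromOpcycles, Category.assoc, cok_k', ← Category.assoc]
    exact null_comp_right N (null_ker N _) _)
  have hes : IsSomeKer N e := by
    refine isSomeKer_corestrict (p := cok N (D.b ≫ D.g')) hg'.isSomeKer_fromCoim ?_ hzk ?_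
    · rw [Category.assoc, coim_fromCoim]; exact isCok_cok N _
    · rw [← cancel_epi (coim N D.g'), ← Category.assoc, hz, Category.assoc, Category.assoc, he,
        cok_fromOpcycles, cok_k', coim_fromCoim_assoc]
  have := isKer_homι (D.eta' ≫ D.xi') D.k' D.null_k'
  rwa [← he, isKer_comp_nmono_iff hes.isNMono] at this

/-- If `ker b ≫ cok f` is exact, then so is `ξ`, and `Ker η ∩ Im ξ` is the image of `v`. -/
theorem exists_fac_v (h : IsExactMor N (ker N D.b ≫ cok N D.f)) :
    ∃ (W : C) (r : kerObj N (D.xi ≫ D.eta) ⟶ W) (j : W ⟶ kerObj N D.eta),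
      IsCok N (ker N D.mu) r ∧ IsKer N (ker N D.eta ≫ cok N D.xi) j ∧ r ≫ j = D.v := by
  have hq := h.isSomeCok_toIm
  have hi := isKer_ker N (cok N (ker N D.b ≫ cok N D.f))
  obtain ⟨j₀, hj₀⟩ := (isKer_ker N D.bCheck).lift (im N (ker N D.b ≫ cok N D.f)) (by
    refine null_im_comp N ?_
    rw [← xi_ker, Category.assoc]
    exact null_comp_left N _ (null_ker N _))
  have hj : IsSomeKer N j₀ := IsSomeKer.of_comp (m := ker N D.bCheck) (by
    rw [hj₀]; exact hi.isSomeKer)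
  have hxi : toIm N (ker N D.b ≫ cok N D.f) ≫ j₀ = D.xi := by
    rw [← cancel_mono (ker N D.bCheck), Category.assoc, hj₀, toIm_im, xi_ker]
  have := hj.mono
  -- All that is needed of `q₀` is that it is a cokernel and that ξ is `q₀` followed by the kernel
  -- `j₀`.
  generalize toIm N (ker N D.b ≫ cok N D.f) = q₀ at hq hxi
  have hm := isKer_ker N (j₀ ≫ D.eta)
  obtain ⟨r, hr⟩ := hm.lift (ker N (D.xi ≫ D.eta) ≫ q₀) (by
    have := null_ker N (D.xi ≫ D.eta)
    rw [Category.assoc, ← Category.assoc q₀, hxi]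
    exact this)
  have hrs : IsSomeCok N r := by
    refine isSomeCok_restrict (k := ker N (D.xi ≫ D.eta)) hq ?_ hm hr
    rw [← Category.assoc, hxi]
    exact isKer_ker N _
  obtain ⟨j, hj'⟩ := (isKer_ker N D.eta).lift (ker N (j₀ ≫ D.eta) ≫ j₀) (by
    rw [Category.assoc]; exact null_ker N _)
  have hrj : r ≫ j = D.v := by
    rw [← cancel_mono (ker N D.eta), v_ker, Category.assoc, hj', ← Category.assoc, hr,
      Category.assoc, hxi]
  -- `j₀` is the image of ξ, so Ker η ∩ Im ξ is both the kernel of `j₀ ≫ η` and the kernel of Ker η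
  -- → Coker ξ.
  have hcok : IsKer N (cok N D.xi) j₀ := by
    refine hj.isKer_of_isCok ?_
    rw [← isCok_nepi_comp_iff hq.isNEpi, hxi]
    exact isCok_cok N _
  have : Mono (j ≫ ker N D.eta) := by rw [hj']; infer_instance
  have : Mono j := mono_of_mono j (ker N D.eta)
  have hjk : IsKer N (ker N D.eta ≫ cok N D.xi) j := by
    refine isKer_of_lift ?_ fun x hx => ?_
    · rw [← Category.assoc, hj', Category.assoc]
      exact null_comp_left N _ hcok.null
    · obtain ⟨x₁, h₁⟩ := hcok.lift (x ≫ ker N D.eta) (by simpa using hx)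
      obtain ⟨x₂, h₂⟩ := hm.lift x₁ (by
        rw [← Category.assoc, h₁, Category.assoc]
        exact null_comp_left N _ (null_ker N _))
      refine ⟨x₂, ?_⟩
      rw [← cancel_mono (ker N D.eta), Category.assoc, hj', ← Category.assoc, h₂, h₁]
  refine ⟨_, r, j, hrs.isCok_of_isKer ?_, hjk, hrj⟩
  -- μ is `r` followed by an N-monomorphism, so `r` has the same kernel as μ.
  have hmono : IsNMono N (j ≫ ker N D.eta ≫ ker N D.bCheck) :=
    IsNMono.comp (g := ker N D.eta ≫ ker N D.bCheck) hjk.isSomeKer.isNMono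
      (IsNMono.comp (f := ker N D.eta) (isNMono_ker N D.eta) (isNMono_ker N D.bCheck))
  rw [← isKer_comp_nmono_iff hmono, ← Category.assoc, hrj, v_mu]
  exact isKer_ker N _

/-- Dual to `exists_fac_v`: the hypothesis makes ξ' a cokernel followed by a kernel, and both
survive division by the image of η'. -/
theorem exists_fac_v' (h : IsExactMor N (ker N D.g' ≫ cok N D.b)) :
    ∃ (W : C) (q : cokObj N D.eta' ⟶ W) (r : W ⟶ cokObj N (D.eta' ≫ D.xi')),
      IsCok N (ker N D.xi' ≫ cok N D.eta') q ∧ IsKer N (cok N D.mu') r ∧ q ≫ r = D.v' := by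
  have hj := h.isSomeKer_fromCoim
  obtain ⟨q₀, hq₀⟩ := (isCok_cok N D.bHat).desc (coim N (ker N D.g' ≫ cok N D.b)) (by
    refine null_comp_coim N ?_
    rw [← cok_xi', ← Category.assoc]
    exact null_comp_right N (null_cok N _) _)
  have hq : IsSomeCok N q₀ := IsSomeCok.of_comp (e := cok N D.bHat) (by
    rw [hq₀]; exact (isCok_cok N _).isSomeCok)
  have hxi : q₀ ≫ fromCoim N (ker N D.g' ≫ cok N D.b) = D.xi' := by
    rw [← cancel_epi (cok N D.bHat), ← Category.assoc, hq₀, coim_fromCoim, cok_xi']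
  have := hq.epi
  generalize fromCoim N (ker N D.g' ≫ cok N D.b) = j₀ at hj hxi
  have hm := isCok_cok N (D.eta' ≫ q₀)
  obtain ⟨r, hr⟩ := hm.desc (j₀ ≫ cok N (D.eta' ≫ D.xi')) (by
    have := null_cok N (D.eta' ≫ D.xi')
    rw [Category.assoc, ← Category.assoc q₀, hxi, ← Category.assoc]
    exact this)
  have hrs : IsSomeKer N r := by
    refine isSomeKer_corestrict (p := cok N (D.eta' ≫ D.xi')) hj ?_ hm hr
    rw [Category.assoc, hxi]
    exact isCok_cok N _
  obtain ⟨q, hq'⟩ := (isCok_cok N D.eta').desc (q₀ ≫ cok N (D.eta' ≫ q₀)) (by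
    rw [← Category.assoc]; exact null_cok N _)
  have hqr : q ≫ r = D.v' := by
    rw [← cancel_epi (cok N D.eta'), cok_v', ← Category.assoc, hq', Category.assoc, hr,
      ← Category.assoc, hxi]
  have hker : IsCok N (ker N D.xi') q₀ := by
    refine hq.isCok_of_isKer ?_
    rw [← isKer_comp_nmono_iff hj.isNMono, hxi]
    exact isKer_ker N _
  have : Epi (cok N D.eta' ≫ q) := by rw [hq']; infer_instance
  have : Epi q := epi_of_epi (cok N D.eta') q
  have hqk : IsCok N (ker N D.xi' ≫ cok N D.eta') q := by
    refine isCok_of_desc ?_ fun x hx => ?_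
    · rw [Category.assoc, hq', ← Category.assoc]
      exact null_comp_right N hker.null _
    · obtain ⟨x₁, h₁⟩ := hker.desc (cok N D.eta' ≫ x) (by simpa using hx)
      obtain ⟨x₂, h₂⟩ := hm.desc x₁ (by
        rw [Category.assoc, h₁, ← Category.assoc]
        exact null_comp_right N (null_cok N _) _)
      refine ⟨x₂, ?_⟩
      rw [← cancel_epi (cok N D.eta'), ← Category.assoc, hq', Category.assoc, h₂, h₁]
  refine ⟨_, q, r, hqk, hrs.isKer_of_isCok ?_, hqr⟩
  have hepi : IsNEpi N ((cok N D.bHat ≫ cok N D.eta') ≫ q) :=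
    IsNEpi.comp (f := cok N D.bHat ≫ cok N D.eta')
      (IsNEpi.comp (g := cok N D.eta') (isNEpi_cok N D.bHat) (isNEpi_cok N D.eta'))
      hqk.isSomeCok.isNEpi
  rw [← isCok_nepi_comp_iff hepi, Category.assoc, hqr, Category.assoc, mu'_v']
  exact isCok_cok N _

/-! Exactness at `Im S` and at `Ker T`. -/

/-- If `g` and `η` are exact, then `Λ` is the cokernel of `Ker η ⟶ Im S` followed by a kernel. -/
theorem exists_fac_lambek (hg : IsExactMor N D.g) (hη : IsExactMor N D.eta) :
    ∃ (I : C) (d₁ : sqIm N D.S ⟶ I) (d₂ : I ⟶ sqKer N D.T),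
      IsCok N (ker N D.eta ≫ D.omega hb) d₁ ∧ IsSomeKer N d₂ ∧ d₁ ≫ d₂ = D.lambek hb := by
  -- This kernel V mediates between Ker b̌ and Ker T: η factors as `y` into V followed by `n`, and Λ
  -- is obtained from `y` on cokernels.
  have hkV := isKer_ker N (fromCoim N D.g ≫ D.c)
  obtain ⟨y, hy⟩ := hkV.lift (ker N D.bCheck ≫ D.opcyclesToCoim) (by
    rw [Category.assoc, ← Category.assoc D.opcyclesToCoim, opcyclesToCoim_fromCoim,
      ← Category.assoc, ← eta_ker, Category.assoc]
    exact null_comp_left N _ (null_ker N _))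
  obtain ⟨n, hn⟩ := (isKer_ker N D.c).lift (ker N (fromCoim N D.g ≫ D.c) ≫ fromCoim N D.g) (by
    rw [Category.assoc]; exact hkV.null)
  -- Exactness of `g` enters here: Coim g → C is a kernel, so V is a normal subobject of C, hence of
  -- Ker c. With η exact, `y` is then a cokernel followed by a kernel.
  have hnk : IsSomeKer N n := IsSomeKer.of_comp (m := ker N D.c) (by
    rw [hn]; exact Homological.ker_comp _ _ hkV.isSomeKer hg.isSomeKer_fromCoim)
  have := hnk.mono
  have hyn : y ≫ n = D.eta := by
    rw [← cancel_mono (ker N D.c), Category.assoc, hn, ← Category.assoc, hy, Category.assoc,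
      opcyclesToCoim_fromCoim, eta_ker]
  have hnc := isCok_cok N n
  obtain ⟨j, hj⟩ := (hnk.isKer_of_isCok hnc).lift (im N D.eta) (by
    refine null_im_comp N ?_
    rw [← hyn, Category.assoc]
    exact null_comp_left N _ hnc.null)
  have hjk : IsSomeKer N j := IsSomeKer.of_comp (m := n) (by
    rw [hj]; exact (isKer_ker N _).isSomeKer)
  have hfac : toIm N D.eta ≫ j = y := by
    rw [← cancel_mono n, Category.assoc, hj, toIm_im, hyn]
  obtain ⟨r, hr⟩ := (isKer_ker N (sqRho N D.T)).lift
    (ker N (fromCoim N D.g ≫ D.c) ≫ sqR' N D.T) (by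
      rw [Category.assoc, sqR'_sqRho]; exact hkV.null)
  -- Homology comparison for Ker b → Coim g → C': the left homology is the cokernel of Ker b → V,
  -- the right one is Ker T.
  have hrk : IsCok N (D.xi ≫ y) r := by
    refine isCok_of_homology (k := ker N (fromCoim N D.g ≫ D.c)) (q := sqR' N D.T)
      (g := sqRho N D.T) (j := sqKerι N D.T) ?_ ?_ (isKer_ker N _) hr
    · rw [sqR'_sqRho]; exact hkV
    · rw [Category.assoc, hy, ← Category.assoc, xi_ker, Category.assoc, cok_opcyclesToCoim]
      exact isCok_of_pushout (isCok_cok N (ker N D.b)) (isCok_cok N (ker N D.g))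
        (isCok_cok N _) (sq_isPushout N D.T).w.symm
  refine exists_fac_cokernels hη.isSomeCok_toIm hjk (k := ker N D.eta) ?_ (D.isCok_omega hb)
    (by rw [hfac]; exact hrk) ?_
  · rw [← isKer_comp_nmono_iff (isKer_ker N (cok N D.eta)).isSomeKer.isNMono, toIm_im]
    exact isKer_ker N _
  · rw [← cancel_mono (sqKerι N D.T), hfac, Category.assoc, Category.assoc, omega_lambek, hr,
      ← Category.assoc, ← hy, Category.assoc]

/-- If `f'` and `η'` are exact, then `Λ` is a cokernel followed by the kernel of
`Ker T ⟶ Coker η'`. -/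
theorem exists_fac_lambek' (hf' : IsExactMor N D.f') (hη' : IsExactMor N D.eta') :
    ∃ (I : C) (d₁ : sqIm N D.S ⟶ I) (d₂ : I ⟶ sqKer N D.T),
      IsSomeCok N d₁ ∧ IsKer N (D.omega' hb ≫ cok N D.eta') d₂ ∧ d₁ ≫ d₂ = D.lambek hb := by
  have hcV := isCok_cok N (D.a ≫ toIm N D.f')
  obtain ⟨y, hy⟩ := hcV.desc (D.imToCycles ≫ cok N D.bHat) (by
    rw [Category.assoc, ← Category.assoc (toIm N D.f'), toIm_imToCycles, ← cok_eta',
      ← Category.assoc]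
    exact null_comp_right N (null_cok N _) _)
  obtain ⟨n, hn⟩ := (isCok_cok N D.a).desc (toIm N D.f' ≫ cok N (D.a ≫ toIm N D.f')) (by
    rw [← Category.assoc]; exact hcV.null)
  -- Exactness of `f'` makes A' → Im f' a cokernel, so the quotient of Im f' by the image of A is
  -- also a quotient of Coker a.
  have hnk : IsSomeCok N n := IsSomeCok.of_comp (e := cok N D.a) (by
    rw [hn]; exact Homological.cok_comp _ _ hf'.isSomeCok_toIm hcV.isSomeCok)
  have := hnk.epi
  have hny : n ≫ y = D.eta' := by
    rw [← cancel_epi (cok N D.a), ← Category.assoc, hn, Category.assoc, hy, ← Category.assoc,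
      toIm_imToCycles, cok_eta']
  have hnc := isKer_ker N n
  obtain ⟨p, hp⟩ := (hnk.isCok_of_isKer hnc).desc (coim N D.eta') (by
    refine null_comp_coim N ?_
    rw [← hny, ← Category.assoc]
    exact null_comp_right N hnc.null _)
  have hpk : IsSomeCok N p := IsSomeCok.of_comp (e := n) (by
    rw [hp]; exact (isCok_cok N _).isSomeCok)
  have hfac : p ≫ fromCoim N D.eta' = y := by
    rw [← cancel_epi n, ← Category.assoc, hp, coim_fromCoim, hny]
  obtain ⟨r, hr⟩ := (isCok_cok N (sqLam N D.S)).desc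
    (sqL' N D.S ≫ cok N (D.a ≫ toIm N D.f')) (by
      rw [← Category.assoc, sqLam_sqL']; exact hcV.null)
  -- Homology comparison for A → Im f' → Coker b: the left homology is Im S.
  have hrk : IsKer N (y ≫ D.xi') r := by
    refine isKer_of_homology (f := sqLam N D.S) (k := sqL' N D.S)
      (q := cok N (D.a ≫ toIm N D.f')) (p := sqImπ N D.S) ?_ ?_ (isCok_cok N _) hr
    · rw [← Category.assoc, hy, Category.assoc, cok_xi', ← Category.assoc, imToCycles_ker]
      exact isKer_of_pullback (isKer_ker N (cok N D.b)) (isKer_ker N (cok N D.f'))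
        (isKer_ker N _) (sq_isPullback N D.S).w.symm
    · rw [sqLam_sqL']; exact hcV
  refine exists_fac_kernels hpk hη'.isSomeKer_fromCoim (k := cok N D.eta') ?_
    (D.isKer_omega' hb) (by rw [hfac]; exact hrk) ?_
  · rw [← isCok_nepi_comp_iff (isCok_cok N (ker N D.eta')).isSomeCok.isNEpi, coim_fromCoim]
    exact isCok_cok N _
  · rw [← cancel_epi (sqImπ N D.S), hfac, lambek_omega', ← hy]
    simpa only [Category.assoc] using (congrArg (· ≫ y) hr).symm

namespace NomuraMaps

variable {D hb} (n : D.NomuraMaps hb)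

/-- Followed by the embedding into Coker f, α becomes the morphism out of the coimage of μ, which is
an N-monomorphism. -/
theorem isNMono_α (hf : IsExactMor N D.f) : IsNMono N n.α := by
  refine IsNMono.of_comp (g := D.theta ≫ ker N D.eta ≫ ker N D.bCheck)
    (isNMono_of_coim (isKer_ker N D.mu) (D.isCok_ker_mu hf) ?_)
  have e := congrArg (· ≫ ker N D.eta ≫ ker N D.bCheck) n.α_eq
  simp only [Category.assoc] at e
  rw [e, v_mu]

theorem isNEpi_α' (hg' : IsExactMor N D.g') : IsNEpi N n.α' := by
  refine IsNEpi.of_comp (f := cok N D.bHat ≫ cok N D.eta' ≫ D.theta')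
    (isNEpi_of_im (isCok_cok N D.mu') (D.isKer_cok_mu' hg') ?_)
  simp only [Category.assoc]
  rw [n.α'_eq, mu'_v']

/-- Both π and the cokernel part of v are coimages of μ, so α agrees up to isomorphisms with the
kernel of Ker η → Coker ξ, which is β up to isomorphisms. -/
theorem isKer_α (hf : IsExactMor N D.f) (h : IsExactMor N (ker N D.b ≫ cok N D.f)) :
    IsKer N n.β n.α := by
  obtain ⟨W, r, j, hr, hj, e⟩ := D.exists_fac_v h
  have hπ := D.isCok_ker_mu hf
  obtain ⟨ε, hε, h₁⟩ := hπ.exists_iso hr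
  have hα : n.α ≫ D.theta = ε ≫ j := by
    rw [← cancel_epi (homπ N D.k (D.xi ≫ D.eta) D.null_k), n.α_eq, ← Category.assoc, h₁, e]
  have := hj.iso_comp ε
  rw [← hα] at this
  have := (isKer_comp_nmono_iff (isNMono_of_isIso (N := N)
    (D.lambekCol ≫ inv (D.lambekSS₁ hb)))).2 this.of_iso_comp
  rw [n.β_eq_omega, omega]
  simpa only [Category.assoc] using this

theorem isCok_α' (hg' : IsExactMor N D.g') (h : IsExactMor N (ker N D.g' ≫ cok N D.b)) :
    IsCok N n.β' n.α' := by
  obtain ⟨W, q, r, hq, hr, e⟩ := D.exists_fac_v' h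
  have hι := D.isKer_cok_mu' hg'
  obtain ⟨ε, hε, h₁⟩ := hι.exists_iso hr
  have hα : D.theta' ≫ n.α' = q ≫ ε := by
    have := hι.mono
    rw [← cancel_mono (homι N (D.eta' ≫ D.xi') D.k' D.null_k'), Category.assoc, n.α'_eq,
      Category.assoc, h₁, e]
  have := hq.comp_iso ε
  rw [← hα] at this
  have := (isCok_nepi_comp_iff (isNEpi_of_isIso (N := N)
    (inv (D.lambekT₁T hb) ≫ D.lambekCol'))).2 this.of_comp_iso
  rw [n.β'_eq_omega', omega']
  simpa only [Category.assoc] using this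

theorem exactAt_lambek (hg : IsExactMor N D.g) (hη : IsExactMor N D.eta) :
    ExactAt N n.β (D.lambek hb) := by
  obtain ⟨I, d₁, d₂, h₁, h₂, e⟩ := D.exists_fac_lambek hb hg hη
  refine exactAt_of_forall n.null_β_lambek fun x hx => ?_
  -- Up to `theta`, β is Ker η → Im S, so its cokernel factors through the cokernel part of Λ; and
  -- `h₂` shows that whatever Λ kills is killed by that part.
  obtain ⟨s, hs⟩ := h₁.desc (cok N n.β) (by
    refine isNEpi_of_isIso D.theta _ ?_
    have := null_cok N n.β
    rw [n.β_eq_omega] at this ⊢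
    simpa only [Category.assoc] using this)
  rw [← hs, ← Category.assoc]
  refine null_comp_right N (h₂.isNMono _ ?_) s
  rwa [Category.assoc, e]

theorem exactAt_β' (hf' : IsExactMor N D.f') (hη' : IsExactMor N D.eta') :
    ExactAt N (D.lambek hb) n.β' := by
  obtain ⟨I, d₁, d₂, h₁, h₂, e⟩ := D.exists_fac_lambek' hb hf' hη'
  refine exactAt_of_forall n.null_lambek_β' fun x hx => ?_
  -- Whatever β' kills lifts to the kernel part of Λ, and the cokernel of Λ kills that part because
  -- `d₁` is an N-epimorphism.
  obtain ⟨s, rfl⟩ := h₂.lift x (by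
    refine isNMono_of_isIso D.theta' _ ?_
    rw [n.β'_eq_omega'] at hx
    simpa only [Category.assoc] using hx)
  rw [Category.assoc]
  refine null_comp_left N s (h₁.isNEpi _ ?_)
  rw [← Category.assoc, e]
  exact null_cok N _

end NomuraMaps

end Diagram

/-! ### Exactness from kernels and cokernels, and the main theorem. -/

theorem IsKer.exactAt {C : Type u} [Category.{v} C] {N : MorphismProperty C} [Semiexact N]
    {X Y Z : C} {f : X ⟶ Y} {g : Y ⟶ Z} (h : IsKer N g f) : ExactAt N f g :=
  exactAt_of_forall h.null fun x hx => by
    obtain ⟨y, rfl⟩ := h.lift x hx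
    rw [Category.assoc]
    exact null_comp_left N y (null_cok N f)

theorem IsCok.exactAt {C : Type u} [Category.{v} C] {N : MorphismProperty C} [Semiexact N]
    {X Y Z : C} {f : X ⟶ Y} {g : Y ⟶ Z} (h : IsCok N f g) : ExactAt N f g :=
  exactAt_of_forall h.null fun x hx => by
    obtain ⟨y, hy⟩ := h.desc (cok N f) (null_cok N f)
    rw [← hy, ← Category.assoc]
    exact null_comp_right N hx y

end GrandisHom

open GrandisHom in
theorem mainTheorem2 {C : Type u} [Category.{v} C] (N : MorphismProperty C) [Homological N]
    (D : Diagram N) (hb : IsExactMor N D.b) :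
    ∃ n : D.NomuraMaps hb,
      -- the defining equations determine the morphisms of the sequence
      (∀ n' : D.NomuraMaps hb, n' = n) ∧
      -- the sequence is null
      (N (n.α ≫ n.β) ∧ N (n.β ≫ D.lambek hb) ∧ N (D.lambek hb ≫ n.β') ∧ N (n.β' ≫ n.α')) ∧
      -- `α` and exactness at `Ker h`
      (IsExactMor N D.f → IsNMono N n.α) ∧
      (IsExactMor N D.f → IsExactMor N (ker N D.b ≫ cok N D.f) →
        IsKer N n.β n.α ∧ ExactAt N n.α n.β) ∧
      -- exactness at `Im S`
      (IsExactMor N D.g → IsExactMor N D.eta →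
        ExactAt N n.β (D.lambek hb) ∧ IsExactMor N (D.lambek hb)) ∧
      -- `α'` and exactness at `Coker h`
      (IsExactMor N D.g' → IsNEpi N n.α') ∧
      (IsExactMor N D.g' → IsExactMor N (ker N D.g' ≫ cok N D.b) →
        IsCok N n.β' n.α' ∧ ExactAt N n.β' n.α') ∧
      -- exactness at `Ker T`
      (IsExactMor N D.f' → IsExactMor N D.eta' →
        ExactAt N (D.lambek hb) n.β' ∧ IsExactMor N (D.lambek hb)) := by
  obtain ⟨n⟩ := D.nonempty_nomuraMaps hb
  refine ⟨n, fun n' => n'.unique n,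
    ⟨n.null_α_β, n.null_β_lambek, n.null_lambek_β', n.null_β'_α'⟩, n.isNMono_α,
    fun hf h => ⟨n.isKer_α hf h, (n.isKer_α hf h).exactAt⟩,
    fun hg hη => ⟨n.exactAt_lambek hg hη, ?_⟩,
    n.isNEpi_α', fun hg' h => ⟨n.isCok_α' hg' h, (n.isCok_α' hg' h).exactAt⟩,
    fun hf' hη' => ⟨n.exactAt_β' hf' hη', ?_⟩⟩
  · obtain ⟨_, _, _, h₁, h₂, e⟩ := D.exists_fac_lambek hb hg hη
    exact isExactMor_of_fac h₁.isSomeCok h₂ e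
  · obtain ⟨_, _, _, h₁, h₂, e⟩ := D.exists_fac_lambek' hb hf' hη'
    exact isExactMor_of_fac h₁ h₂.isSomeKer e
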